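/- Let $(S,+)$ be a countable Abelian group with at least two elements. For $1\le p<\infty$ let $\ell^p(S)$ be the space of functions $u:S\to\mathbb R$ with $\|u\|_p=(\sum_{i\in S}|u(i)|^p)^{1/p}<\infty$, let $\|u\|_\infty=\sup_{i}|u(i)|$ (norms of restrictions $u|_B$ to $B\subset S$ are taken over $B$, and equal $0$ if $B=\emptyset$), and let $(u*v)(i)=\sum_{j\in S}u(i-j)v(j)$ denote convolution. For integers $d\ge 2$ and $n\ge 1$ let $\rho=\rho(d,n)$ be the unique positive number such that $$(d-1)\rho^{d+1}+dn\,\rho^{d-1}-n=0,$$ and set $$\eta(d,n)=\frac{\rho-\rho^d}{(\rho^{d+1}+n)^{\frac{d}{d+1}}},\qquad \lambda_d=d^{-\frac{1}{d-1}}.$$ **Proposition (existence of solutions of the boundary law equation).** Let $d\ge 2$ and $n\ge 1$ be integers, let $Q\in\ell^{\frac{d+1}{2}}(S)$ be a positive function with $Q(0)=1$, set $q:=Q-\mathbb 1_{\{0\}}$, and assume that $$\|q\|_{\frac{d+1}{2}}\le\eta(d,n).$$ Then for every subset $A\subset S$ with $|A|=n$ there exists a positive function $\overline x\in\ell^{d+1}(S)$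 such that $$\overline x=Q*\overline x^{\,d},\qquad \|\overline x|_{A^c}\|_\infty\le\|\overline x|_{A^c}\|_{d+1}<\rho(d,n)<\lambda_d<\overline x|_A<1,$$ where inequalities involving $\overline x|_A$ are pointwise on $A$. Moreover, the same $\overline x$ satisfies: 1. $\displaystyle\|\overline x|_{A^c}\|_{d+1}\le\frac{\rho(d,n)}{\eta(d,n)}\,\|q\|_{\frac{d+1}{2}}$; 2. $\displaystyle 0<1-\overline x|_A\le\frac{d^{\frac{d}{d-1}}-d}{d-1}\,(1+n)^{\frac{d}{d+1}}\,\|q\|_{\frac{d+1}{2}}$; 3. $\displaystyle\overline x(i)\ge\Bigl(1-\frac{d}{d-1}\bigl(d^{\frac{d}{d-1}}-d\bigr)(1+n)^{\frac{d}{d+1}}\,\|q\|_{\frac{d+1}{2}}\Bigr)\sum_{j\in A}Q(i-j)$ for every $i\in A^c$. -/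

import Mathlib

open scoped ENNReal

/-- For `p ≤ q`, the restriction of `x ∈ ℓ^p(S)` to a subset `B`, as an element of `ℓ^q(B)`. -/
def lpRestrict {S : Type*} (B : Set S) {p q : ℝ≥0∞} (hpq : p ≤ q)
    (x : lp (fun _ : S => ℝ) p) : lp (fun _ : B => ℝ) q :=
  ⟨fun i => x i, by
    have hx : Memℓp (fun i : S => x i) p := lp.memℓp x
    have hB : Memℓp (E := fun _ : B => ℝ) (fun i : B => x i) p := by
      rcases p.trichotomy with rfl | rfl | hp
      · exact memℓp_zero
          ((memℓp_zero_iff.1 hx).preimage (f := ((↑) : B → S)) Subtype.val_injective.injOn)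
      · refine memℓp_infty ((memℓp_infty_iff.1 hx).mono ?_)
        rintro _ ⟨i, rfl⟩
        exact ⟨i, rfl⟩
      · exact memℓp_gen (((memℓp_gen_iff hp).1 hx).comp_injective Subtype.val_injective)
    exact hB.of_exponent_ge hpq⟩

@[simp]
theorem lpRestrict_apply {S : Type*} (B : Set S) {p q : ℝ≥0∞} (hpq : p ≤ q)
    (x : lp (fun _ : S => ℝ) p) (i : B) : lpRestrict B hpq x i = x i := rfl

/-- The convolution `(u * v)(i) = ∑ j, u (i - j) v (j)` on an Abelian group. -/
noncomputable def groupConv {S : Type*} [AddCommGroup S] (u v : S → ℝ) (i : S) : ℝ :=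
  ∑' j, u (i - j) * v j

/-- The positive solutions `r` of `(d - 1) r ^ (d + 1) + d n r ^ (d - 1) - n = 0`. -/
def rhoRoots (d n : ℕ) : Set ℝ :=
  {r : ℝ | 0 < r ∧ ((d : ℝ) - 1) * r ^ (d + 1) + d * n * r ^ (d - 1) - n = 0}

/-- For `2 ≤ d` and `1 ≤ n` the equation defining `ρ(d,n)` has exactly one positive solution. -/
theorem existsUnique_rhoRoots (d n : ℕ) (hd : 2 ≤ d) (hn : 1 ≤ n) :
    ∃! r : ℝ, r ∈ rhoRoots d n := by
  have hd' : (2 : ℝ) ≤ d := by exact_mod_cast hd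
  have hn' : (1 : ℝ) ≤ n := by exact_mod_cast hn
  have hmono : ∀ a b : ℝ, 0 < a → a < b →
      ((d : ℝ) - 1) * a ^ (d + 1) + d * n * a ^ (d - 1) - n
        < ((d : ℝ) - 1) * b ^ (d + 1) + d * n * b ^ (d - 1) - n := by
    intro a b ha hab
    have h1 : a ^ (d + 1) < b ^ (d + 1) := pow_lt_pow_left₀ hab ha.le (by omega)
    have h2 : a ^ (d - 1) < b ^ (d - 1) := pow_lt_pow_left₀ hab ha.le (by omega)
    have h3 := mul_lt_mul_of_pos_left h1 (by linarith : (0 : ℝ) < (d : ℝ) - 1)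
    have h4 := mul_lt_mul_of_pos_left h2 (by positivity : (0 : ℝ) < (d : ℝ) * n)
    linarith
  have hcont : Continuous
      (fun r : ℝ => ((d : ℝ) - 1) * r ^ (d + 1) + d * n * r ^ (d - 1) - n) := by fun_prop
  have hz : d - 1 ≠ 0 := by omega
  obtain ⟨r, hr, hr0⟩ := intermediate_value_Icc (zero_le_one (α := ℝ)) hcont.continuousOn
    (show (0 : ℝ) ∈ Set.Icc _ _ by
      constructor
      · simp [hz]
      · simp only [one_pow, mul_one]
        nlinarith)
  have hrpos : 0 < r := by
    rcases hr.1.eq_or_lt with h | h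
    · exfalso
      rw [← h] at hr0
      simp [hz] at hr0
      omega
    · exact h
  refine ⟨r, ⟨hrpos, hr0⟩, ?_⟩
  rintro s ⟨hs, hs0⟩
  simp only at hr0
  rcases lt_trichotomy s r with h | h | h
  · have := hmono s r hs h
    linarith
  · exact h
  · have := hmono r s hrpos h
    linarith

/-- `ρ(d,n)`: the unique positive root (the infimum is that of a singleton, see `rho_spec`). -/
noncomputable def rho (d n : ℕ) : ℝ := sInf (rhoRoots d n)

theorem rho_spec (d n : ℕ) (hd : 2 ≤ d) (hn : 1 ≤ n) : rhoRoots d n = {rho d n} := by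
  obtain ⟨r, hr, hu⟩ := existsUnique_rhoRoots d n hd hn
  have h : rhoRoots d n = {r} := by
    ext s
    exact ⟨fun hs => hu s hs, fun hs => by rw [Set.mem_singleton_iff.1 hs]; exact hr⟩
  rw [rho, h, csInf_singleton]

/-- `η(d,n) = (ρ - ρ ^ d) / (ρ ^ (d + 1) + n) ^ (d / (d + 1))` with `ρ = ρ(d,n)`. -/
noncomputable def eta (d n : ℕ) : ℝ :=
  (rho d n - rho d n ^ d) / (rho d n ^ (d + 1) + n) ^ ((d : ℝ) / ((d : ℝ) + 1))

/-- `λ_d = d ^ (-1 / (d - 1))`. -/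
noncomputable def lam (d : ℕ) : ℝ := (d : ℝ) ^ (-(1 / ((d : ℝ) - 1)))

/-! With `q = Q - 1_{0}` the equation reads `x - x ^ d = y`, where `y = q * x ^ d`. Young's
inequality gives `‖y‖_{d+1} ≤ ‖q‖_{(d+1)/2} ‖x‖_{d+1} ^ d`. So if `x` has norm at most `ρ` off `A`
and values in `[0, 1]` on the `n` points of `A`, the definition of `η` yields `‖y‖_{d+1} ≤ ρ - ρ ^
d`. Off `A`, the map `x ^ d + y` then keeps the norm at most `ρ`. On `A`, `t - t ^ d` increases up
to its critical point `λ_d > ρ`, so `y ≤ ρ - ρ ^ d < λ_d - λ_d ^ d`, and the residual `x - x ^ d -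
y` points into `[λ_d, 1]` at both ends.

Brouwer's theorem, obtained here from Sperner's lemma (`kuhnCount_eq_one`), therefore solves the
equation on every finite set containing `A` (`exists_truncated_solution`). Such solutions converge
pointwise along an ultrafilter, and Hölder's inequality makes the tails of the convolution uniformly
small, so the limit solves the full equation (`exists_boundaryLaw`).

Strictness and the quantitative bounds are read off the limit: `y > 0` forces `x < 1`, hence `‖x‖ ^
(d+1) < ρ ^ (d+1) + n`, and Young's inequality is applied once more with this improvement. -/

open Filter Topology

/-! ### Sperner's lemma modulo two for Kuhn's triangulation -/

/-- The `k`-th vertex of the monotone lattice path from `u` which steps in direction `j` at time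
`τ j`. -/
def kuhnVertex {n : ℕ} (u : Fin n → ℕ) (τ : Equiv.Perm (Fin n)) (k : ℕ) (j : Fin n) : ℕ :=
  u j + if (τ j : ℕ) < k then 1 else 0

/-- The incidence matrix of a sequence of labels, modulo two. -/
def labelMatrix {m : ℕ} (L : Fin m → ℕ) : Matrix (Fin m) (Fin m) (ZMod 2) :=
  fun k l => if L k = l then 1 else 0

theorem det_labelMatrix_eq_zero {m : ℕ} {L : Fin m → ℕ} (l : Fin m) (h : ∀ k, L k ≠ l) :
    (labelMatrix L).det = 0 :=
  Matrix.det_eq_zero_of_column_eq_zero l fun k => by simp [labelMatrix, h k]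

/-- A sequence of `n + 1` labels is complete modulo two iff the number of its complete facets is
odd. -/
theorem det_labelMatrix_eq_sum {n : ℕ} (L : Fin (n + 1) → ℕ) (hL : ∀ k, L k ≤ n) :
    (labelMatrix L).det
      = ∑ k : Fin (n + 1), (labelMatrix fun a : Fin n => L (k.succAbove a)).det := by
  -- Each row has exactly one entry 1, so replacing the last column by the sum of all columns makes
  -- it constant 1 and keeps the determinant. In the expansion along it signs vanish modulo two, and
  -- the minors are the facets, complete when they carry the labels `0, …, n - 1`.
  have h1 := Matrix.det_updateCol_sum (labelMatrix L) (Fin.last n) (fun _ => 1)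
  rw [one_smul] at h1
  rw [← h1, Matrix.det_succ_column _ (Fin.last n)]
  refine Finset.sum_congr rfl fun k _ => ?_
  have h2 : ∀ a : ZMod 2, (-1) ^ (k + Fin.last n : ℕ) * 1 * a = a := by
    intro a
    rw [show (-1 : ZMod 2) = 1 by decide, one_pow, one_mul, one_mul]
  have h3 : ((labelMatrix L).updateCol (Fin.last n)
      (fun i => ∑ l, (1 : ZMod 2) • labelMatrix L i l)) k (Fin.last n) = 1 := by
    rw [Matrix.updateCol_self]
    simp only [one_smul, labelMatrix]
    rw [Finset.sum_eq_single (⟨L k, Nat.lt_succ_of_le (hL k)⟩ : Fin (n + 1))]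
    · simp
    · intro b _ hb
      rw [if_neg]
      rintro h
      exact hb (Fin.ext h.symm)
    · simp
  simp only [smul_eq_mul, one_mul] at h3 ⊢
  rw [h3, h2]
  congr 1
  ext a b
  simp [Matrix.submatrix, labelMatrix, Matrix.updateCol_apply, Fin.ext_iff, b.2.ne]

theorem kuhnVertex_swap_mul {n : ℕ} (u : Fin n → ℕ) (τ : Equiv.Perm (Fin n)) (p q : Fin n)
    (hpq : (p : ℕ) + 1 = q) (a : ℕ) (ha : a ≠ q) :
    kuhnVertex u (Equiv.swap p q * τ) a = kuhnVertex u τ a := by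
  ext j
  simp only [kuhnVertex, Equiv.Perm.mul_apply]
  congr 1
  refine if_congr ?_ rfl rfl
  rw [Equiv.swap_apply_def]
  split_ifs with h1 h2
  · rw [h1]; omega
  · rw [h2]; omega
  · rfl

/-- The facet of the Kuhn simplex `(u, τ)` opposite to its `k`-th vertex, as a sequence of
labels. -/
def facetLabels {n : ℕ} (L : (Fin n → ℕ) → ℕ) (u : Fin n → ℕ) (τ : Equiv.Perm (Fin n))
    (k : Fin (n + 1)) (a : Fin n) : ℕ :=
  L (kuhnVertex u τ (k.succAbove a : Fin (n + 1)))

/-- Exchanging the steps of the path just before and just after its `k`-th vertex moves that vertex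
only. This fixed-point-free involution pairs the two simplices sharing the opposite facet, which
cancel modulo two. -/
theorem sum_facetLabels_inner {n : ℕ} (L : (Fin n → ℕ) → ℕ) (u : Fin n → ℕ)
    (k : Fin (n + 1)) (h0 : k ≠ 0) (h1 : k ≠ Fin.last n) :
    ∑ τ : Equiv.Perm (Fin n), (labelMatrix (facetLabels L u τ k)).det = 0 := by
  have hk0 : 0 < (k : ℕ) := Nat.pos_of_ne_zero fun h => h0 (Fin.ext h)
  have hk1 : (k : ℕ) < n := lt_of_le_of_ne (Nat.le_of_lt_succ k.2) fun h => h1 (Fin.ext h)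
  let p : Fin n := ⟨k - 1, by omega⟩
  let q : Fin n := ⟨k, hk1⟩
  have hpq : (p : ℕ) + 1 = q := by simp only [p, q]; omega
  have hne : p ≠ q := fun h => by rw [h] at hpq; omega
  refine Finset.sum_involution (fun τ _ => Equiv.swap p q * τ) ?_ ?_ ?_ ?_
  · intro τ _
    have : facetLabels L u (Equiv.swap p q * τ) k = facetLabels L u τ k := by
      ext a
      rw [facetLabels, kuhnVertex_swap_mul u τ p q hpq, facetLabels]
      intro h
      exact Fin.succAbove_ne k a (Fin.ext h)
    rw [this]
    exact CharTwo.add_self_eq_zero _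
  · intro τ _ _ h
    rw [mul_eq_right, Equiv.swap_eq_one_iff] at h
    exact hne h
  · intro τ _
    exact Finset.mem_univ _
  · intro τ _
    simp

/-- Moving the last step of a path to the front gives a path whose vertices after the first are
those of the translated path, without its final one. Hence the facet opposite vertex `0` is also a
facet, opposite the last vertex, of the neighbouring simplex. -/
theorem kuhnVertex_rotate {m : ℕ} (u : Fin (m + 1) → ℕ) (τ : Equiv.Perm (Fin (m + 1)))
    (a : ℕ) (ha : a ≤ m) :
    kuhnVertex u (τ.trans (finRotate (m + 1))) (a + 1)
      = kuhnVertex (fun j => u j + if j = τ.symm (Fin.last m) then 1 else 0) τ a := by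
  ext j
  have hrot : (τ.trans (finRotate (m + 1))) j = finRotate (m + 1) (τ j) := rfl
  simp only [kuhnVertex, Equiv.eq_symm_apply, hrot]
  rcases eq_or_ne (τ j) (Fin.last m) with h | h
  · simp [h, Nat.not_lt.2 ha]
  · rw [if_neg h, add_zero]
    refine congrArg _ (if_congr ?_ rfl rfl)
    rw [coe_finRotate_of_ne_last h, Nat.add_lt_add_iff_right]

theorem facetLabels_zero {m : ℕ} (L : (Fin (m + 1) → ℕ) → ℕ) (u : Fin (m + 1) → ℕ)
    (τ : Equiv.Perm (Fin (m + 1))) :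
    facetLabels L u (τ.trans (finRotate (m + 1))) 0
      = facetLabels L (fun j => u j + if j = τ.symm (Fin.last m) then 1 else 0) τ
        (Fin.last _) := by
  ext a
  simp only [facetLabels, Fin.succAbove_zero, Fin.succAbove_last, Fin.val_succ,
    Fin.val_castSucc]
  rw [kuhnVertex_rotate u τ a (Nat.le_of_lt_succ a.2)]

/-- The number of completely labelled Kuhn simplices of the grid `{0, …, N} ^ n`, modulo two. -/
def kuhnCount (N n : ℕ) (L : (Fin n → ℕ) → ℕ) : ZMod 2 :=
  ∑ u : Fin n → Fin N, ∑ τ : Equiv.Perm (Fin n),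
    (labelMatrix fun k : Fin (n + 1) => L (kuhnVertex (fun j => (u j : ℕ)) τ k)).det

theorem kuhnCount_succ_eq_facets (N m : ℕ) (L : (Fin (m + 1) → ℕ) → ℕ)
    (hL : ∀ v, L v ≤ m + 1) :
    kuhnCount N (m + 1) L
      = ∑ τ : Equiv.Perm (Fin (m + 1)), ∑ u : Fin (m + 1) → Fin N,
        ((labelMatrix (facetLabels L (fun j => (u j : ℕ)) τ (Fin.last _))).det
          + (labelMatrix (facetLabels L
            (fun j => (u j : ℕ) + if j = τ.symm (Fin.last m) then 1 else 0) τ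
              (Fin.last _))).det) := by
  rw [Finset.sum_comm, kuhnCount]
  refine Finset.sum_congr rfl fun u _ => ?_
  have h1 : ∀ τ : Equiv.Perm (Fin (m + 1)), (labelMatrix fun k : Fin (m + 1 + 1) =>
      L (kuhnVertex (fun j => (u j : ℕ)) τ k)).det
        = ∑ k, (labelMatrix (facetLabels L (fun j => (u j : ℕ)) τ k)).det := fun τ =>
    det_labelMatrix_eq_sum _ fun k => hL _
  simp only [h1]
  have h2 : ∀ k : Fin m, ∑ τ : Equiv.Perm (Fin (m + 1)),
      (labelMatrix (facetLabels L (fun j => (u j : ℕ)) τ k.castSucc.succ)).det = 0 := by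
    intro k
    refine sum_facetLabels_inner L _ _ (Fin.succ_ne_zero _) ?_
    rw [Fin.succ_castSucc]
    exact (Fin.castSucc_lt_last _).ne
  rw [Finset.sum_comm, Fin.sum_univ_succ, Fin.sum_univ_castSucc]
  simp only [h2]
  rw [Finset.sum_const_zero, zero_add, Finset.sum_add_distrib, add_comm]
  refine congrArg₂ (· + ·) rfl ?_
  rw [← Equiv.sum_comp (Equiv.mulLeft (finRotate (m + 1)))
    (fun τ => (labelMatrix (facetLabels L (fun j => (u j : ℕ)) τ 0)).det)]
  refine Finset.sum_congr rfl fun τ _ => ?_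
  rw [← facetLabels_zero]
  rfl

/-- Telescoping modulo two. -/
theorem sum_add_succ_zmod_two (g : ℕ → ZMod 2) (N : ℕ) :
    ∑ a : Fin N, (g a + g (a + 1)) = g 0 + g N := by
  rw [Fin.sum_univ_eq_sum_range (fun a => g a + g (a + 1))]
  induction N with
  | zero => simp [CharTwo.add_self_eq_zero]
  | succ N ih =>
    rw [Finset.sum_range_succ, ih]
    linear_combination CharTwo.add_self_eq_zero (g N)

/-- Once `τ` is fixed, facets opposite the last vertex lie in hyperplanes orthogonal to the
direction `c` of the last step. Summing over the coordinate of `u` along `c` telescopes modulo two,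
leaving only the faces at heights `0` and `N`. -/
theorem kuhnCount_succ_eq_boundary (N m : ℕ) (L : (Fin (m + 1) → ℕ) → ℕ)
    (hL : ∀ v, L v ≤ m + 1) :
    kuhnCount N (m + 1) L
      = ∑ τ : Equiv.Perm (Fin (m + 1)), ∑ v : Fin m → Fin N,
        ((labelMatrix (facetLabels L
            ((τ.symm (Fin.last m)).insertNth 0 (fun j => (v j : ℕ))) τ (Fin.last _))).det
          + (labelMatrix (facetLabels L
            ((τ.symm (Fin.last m)).insertNth N (fun j => (v j : ℕ))) τ (Fin.last _))).det) := by
  rw [kuhnCount_succ_eq_facets N m L hL]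
  refine Finset.sum_congr rfl fun τ _ => ?_
  set c := τ.symm (Fin.last m)
  rw [← Equiv.sum_comp (Fin.insertNthEquiv (fun _ => Fin N) c), Fintype.sum_prod_type_right]
  refine Finset.sum_congr rfl fun v _ => ?_
  rw [← sum_add_succ_zmod_two (fun a => (labelMatrix (facetLabels L
    (c.insertNth a (fun j => (v j : ℕ))) τ (Fin.last _))).det)]
  refine Finset.sum_congr rfl fun a _ => ?_
  congr 4
  · ext j
    refine Fin.succAboveCases c ?_ (fun i => ?_) j <;> simp
  · ext j
    refine Fin.succAboveCases c ?_ (fun i => ?_) j <;> simp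

theorem kuhnVertex_insertNth_self {m : ℕ} (τ : Equiv.Perm (Fin (m + 1))) (x : ℕ)
    (v : Fin m → ℕ) (k : ℕ) (hk : k ≤ m) :
    kuhnVertex ((τ.symm (Fin.last m)).insertNth x v) τ k (τ.symm (Fin.last m)) = x := by
  simp [kuhnVertex, hk]

/-- Extend a permutation of `Fin m` by the last element. -/
def permSnoc {m : ℕ} (τ : Equiv.Perm (Fin m)) : Equiv.Perm (Fin (m + 1)) where
  toFun := Fin.snoc (α := fun _ => Fin (m + 1)) (fun i => (τ i).castSucc) (Fin.last m)
  invFun := Fin.snoc (α := fun _ => Fin (m + 1)) (fun i => (τ.symm i).castSucc) (Fin.last m)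
  left_inv := by
    intro j
    refine Fin.lastCases ?_ (fun i => ?_) j <;> simp
  right_inv := by
    intro j
    refine Fin.lastCases ?_ (fun i => ?_) j <;> simp

theorem permSnoc_last {m : ℕ} (τ : Equiv.Perm (Fin m)) : permSnoc τ (Fin.last m) = Fin.last m := by
  simp [permSnoc]

theorem permSnoc_castSucc {m : ℕ} (τ : Equiv.Perm (Fin m)) (i : Fin m) :
    permSnoc τ i.castSucc = (τ i).castSucc := by
  simp [permSnoc]

theorem permSnoc_injective {m : ℕ} : Function.Injective (permSnoc (m := m)) := by
  intro τ σ h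
  ext i
  have := congrArg (fun ρ => ρ i.castSucc) h
  simp only [permSnoc_castSucc] at this
  exact congrArg Fin.val (Fin.castSucc_injective _ this)

theorem exists_permSnoc_eq {m : ℕ} (τ : Equiv.Perm (Fin (m + 1)))
    (h : τ (Fin.last m) = Fin.last m) : ∃ σ, permSnoc σ = τ := by
  have hne : ∀ i : Fin m, τ i.castSucc ≠ Fin.last m := fun i hi =>
    (Fin.castSucc_lt_last i).ne (τ.injective (hi.trans h.symm))
  have hinj : Function.Injective fun i : Fin m => (τ i.castSucc).castPred (hne i) := by
    intro i j hij
    exact Fin.castSucc_injective _ (τ.injective (Fin.castPred_inj.1 hij))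
  refine ⟨Equiv.ofBijective _ (Finite.injective_iff_bijective.1 hinj), ?_⟩
  ext j
  refine Fin.lastCases ?_ (fun i => ?_) j
  · rw [permSnoc_last, h]
  · rw [permSnoc_castSucc]
    simp

theorem kuhnVertex_snoc {m : ℕ} (τ : Equiv.Perm (Fin m)) (v : Fin m → ℕ) (k : ℕ) (hk : k ≤ m) :
    kuhnVertex (Fin.snoc (α := fun _ => ℕ) v 0) (permSnoc τ) k
      = Fin.snoc (α := fun _ => ℕ) (kuhnVertex v τ k) 0 := by
  ext j
  refine Fin.lastCases ?_ (fun i => ?_) j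
  · simp [kuhnVertex, permSnoc_last, hk]
  · simp [kuhnVertex, permSnoc_castSucc]

/-- **Sperner's lemma** for Kuhn's triangulation of the cube. -/
theorem kuhnCount_eq_one (N n : ℕ) (L : (Fin n → ℕ) → ℕ) (hL : ∀ v, L v ≤ n)
    (h0 : ∀ v (j : Fin n), v j = 0 → L v ≤ j)
    (h1 : ∀ v (j : Fin n), v j = N → L v ≠ j) :
    kuhnCount N n L = 1 := by
  induction n with
  | zero =>
    have : ∀ v, L v = 0 := fun v => Nat.le_zero.1 (hL v)
    simp [kuhnCount, labelMatrix, this]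
  | succ m ih =>
    rw [kuhnCount_succ_eq_boundary N m L hL]
    -- On the face at height `N` in direction `c` the label `c` is missing.
    have hN0 : ∀ (τ : Equiv.Perm (Fin (m + 1))) (v : Fin m → Fin N), (labelMatrix (facetLabels L
        ((τ.symm (Fin.last m)).insertNth N (fun j => (v j : ℕ))) τ (Fin.last _))).det = 0 := by
      intro τ v
      refine det_labelMatrix_eq_zero (τ.symm (Fin.last m)) fun k => ?_
      refine h1 _ _ ?_
      rw [Fin.succAbove_last]
      exact kuhnVertex_insertNth_self τ _ _ _ (Nat.le_of_lt_succ k.2)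
    -- On the face at height `0` in direction `c` labels are at most `c`. Unless `c` is the last
    -- direction, the label `m` is therefore missing.
    have h00 : ∀ (τ : Equiv.Perm (Fin (m + 1))) (v : Fin m → Fin N),
        τ (Fin.last m) ≠ Fin.last m → (labelMatrix (facetLabels L
        ((τ.symm (Fin.last m)).insertNth 0 (fun j => (v j : ℕ))) τ (Fin.last _))).det = 0 := by
      intro τ v hτ
      refine det_labelMatrix_eq_zero (Fin.last m) fun k => ?_
      have h2 : facetLabels L ((τ.symm (Fin.last m)).insertNth 0 (fun j => (v j : ℕ))) τ
          (Fin.last _) k ≤ τ.symm (Fin.last m) := by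
        refine h0 _ _ ?_
        rw [Fin.succAbove_last]
        exact kuhnVertex_insertNth_self τ _ _ _ (Nat.le_of_lt_succ k.2)
      have h3 : τ.symm (Fin.last m) ≠ Fin.last m := fun h => hτ (by
        rw [Equiv.symm_apply_eq] at h; exact h.symm)
      exact (lt_of_le_of_lt h2 (Fin.lt_last_iff_ne_last.2 h3)).ne
    simp only [hN0, add_zero]
    -- What survives is the bottom face in the last direction, with permutations fixing the last
    -- element: a copy of the problem in dimension `m`.
    rw [← ih (fun v => L (Fin.snoc (α := fun _ => ℕ) v 0))]
    · rw [kuhnCount, Finset.sum_comm]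
      symm
      rw [Finset.sum_comm]
      symm
      rw [Finset.sum_comm]
      symm
      refine Finset.sum_of_injOn permSnoc permSnoc_injective.injOn (by simp) ?_ ?_
      · intro τ _ hτ
        refine Finset.sum_eq_zero fun v _ => h00 τ v fun h => hτ ?_
        obtain ⟨σ, rfl⟩ := exists_permSnoc_eq τ h
        simp
      · intro τ _
        refine Finset.sum_congr rfl fun v _ => ?_
        have h4 : (permSnoc τ).symm (Fin.last m) = Fin.last m := by
          rw [Equiv.symm_apply_eq, permSnoc_last]
        congr 2
        ext k
        rw [facetLabels, h4, Fin.insertNth_last', Fin.succAbove_last, Fin.val_castSucc,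
          kuhnVertex_snoc _ _ _ (Nat.le_of_lt_succ k.2)]
    · intro v
      have := h0 (Fin.snoc (α := fun _ => ℕ) v 0) (Fin.last m) (by simp)
      simpa using this
    · intro v j hj
      exact h0 (Fin.snoc (α := fun _ => ℕ) v 0) j.castSucc (by simpa using hj)
    · intro v j hj
      exact h1 (Fin.snoc (α := fun _ => ℕ) v 0) j.castSucc (by simpa using hj)

/-- A proper labelling of the grid has a completely labelled Kuhn simplex. -/
theorem exists_complete_kuhn_simplex (N n : ℕ) (L : (Fin n → ℕ) → ℕ)
    (hL : ∀ v, L v ≤ n) (h0 : ∀ v (j : Fin n), v j = 0 → L v ≤ j)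
    (h1 : ∀ v (j : Fin n), v j = N → L v ≠ j) :
    ∃ (u : Fin n → ℕ) (τ : Equiv.Perm (Fin n)), (∀ j, u j < N) ∧
      ∀ l ≤ n, ∃ k, L (kuhnVertex u τ k) = l := by
  by_contra! hcon
  have h : kuhnCount N n L = 0 := by
    refine Finset.sum_eq_zero fun u _ => Finset.sum_eq_zero fun τ _ => ?_
    obtain ⟨l, hl, hk⟩ := hcon (fun j => (u j : ℕ)) τ fun j => (u j).2
    exact det_labelMatrix_eq_zero ⟨l, Nat.lt_succ_of_le hl⟩ fun k => hk k
  rw [kuhnCount_eq_one N n L hL h0 h1] at h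
  exact one_ne_zero h

/-! ### Brouwer's fixed point theorem on the cube -/

/-- A labelling by the first coordinate where `b` fails. -/
theorem exists_first_failure_label {V : Type*} (n : ℕ) (b : V → Fin n → Prop) :
    ∃ L : V → ℕ, (∀ v, L v ≤ n) ∧ (∀ v j, ¬ b v j → L v ≤ j) ∧ (∀ v (j : Fin n), L v = j → ¬ b v j) ∧
      ∀ v, L v = n → ∀ j, b v j := by
  classical
  have hex : ∀ v, ∃ k : ℕ, k = n ∨ ∃ h : k < n, ¬ b v ⟨k, h⟩ := fun v => ⟨n, Or.inl rfl⟩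
  refine ⟨fun v => Nat.find (hex v), fun v => Nat.find_min' _ (Or.inl rfl),
    fun v j hj => Nat.find_min' _ (Or.inr ⟨j.2, hj⟩), ?_, ?_⟩
  · intro v j hj
    rcases Nat.find_spec (hex v) with h | ⟨h, h'⟩
    · exact absurd (hj.symm.trans h) j.2.ne
    · have : (⟨Nat.find (hex v), h⟩ : Fin n) = j := Fin.ext hj
      rwa [this] at h'
  · intro v hv j
    by_contra hj
    have : Nat.find (hex v) ≤ j := Nat.find_min' _ (Or.inr ⟨j.2, hj⟩)
    have hv' : Nat.find (hex v) = n := hv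
    have := j.2
    omega

/-- A completely labelled cell of mesh `1 / N` has, for every `j`, a vertex that `f` does not move
down in direction `j`, and one vertex that it moves up in no direction. Continuity is needed only in
the limit. -/
theorem exists_approx_fixedPoint_cube {n : ℕ} (f : (Fin n → ℝ) → Fin n → ℝ)
    (hmaps : Set.MapsTo f (Set.Icc 0 1) (Set.Icc 0 1)) (N : ℕ) (hN : 0 < N) :
    ∃ p ∈ Set.Icc (0 : Fin n → ℝ) 1, ∀ j,
      (∃ a ∈ Set.Icc (0 : Fin n → ℝ) 1, dist a p ≤ 1 / N ∧ a j ≤ f a j) ∧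
      ∃ a ∈ Set.Icc (0 : Fin n → ℝ) 1, dist a p ≤ 1 / N ∧ f a j ≤ a j := by
  have hN' : (0 : ℝ) < N := by exact_mod_cast hN
  -- The minimum matters only outside the grid, since labels are assigned to all of `Fin n → ℕ`.
  let pt : (Fin n → ℕ) → Fin n → ℝ := fun v j => ((min (v j) N : ℕ) : ℝ) / N
  have hpt : ∀ v, pt v ∈ Set.Icc (0 : Fin n → ℝ) 1 := by
    intro v
    refine ⟨fun j => by simp only [pt, Pi.zero_apply]; positivity, fun j => ?_⟩
    simp only [pt, Pi.one_apply]
    rw [div_le_one hN']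
    exact_mod_cast min_le_right _ _
  obtain ⟨L, hL, hL1, hL2, hL3⟩ := exists_first_failure_label n
    -- The clauses `v j ≠ 0` and `v j = N` enforce the boundary conditions of Sperner's lemma;
    -- elsewhere the condition says that `f` does not increase coordinate `j`.
    (fun (v : Fin n → ℕ) j => v j ≠ 0 ∧ (v j = N ∨ f (pt v) j ≤ pt v j))
  obtain ⟨u, τ, hu, hfull⟩ := exists_complete_kuhn_simplex N n L hL
    (fun v j hv => hL1 v j fun h => h.1 hv)
    (fun v j hv h => hL2 v j h ⟨by omega, Or.inl hv⟩)
  have hdist : ∀ k, dist (pt (kuhnVertex u τ k)) (pt u) ≤ 1 / N := by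
    intro k
    rw [dist_pi_le_iff (by positivity)]
    intro j
    simp only [pt, Real.dist_eq]
    rw [← sub_div, abs_div, abs_of_pos hN']
    refine div_le_div_of_nonneg_right ?_ hN'.le
    have h1 : kuhnVertex u τ k j ≤ N := by
      have := hu j
      simp only [kuhnVertex]; split_ifs <;> omega
    rw [min_eq_left h1, min_eq_left (hu j).le]
    simp only [kuhnVertex]
    split_ifs <;> simp
  refine ⟨pt u, hpt u, fun j => ⟨?_, ?_⟩⟩
  · obtain ⟨k, hk⟩ := hfull j j.2.le
    refine ⟨_, hpt _, hdist k, ?_⟩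
    have h := hL2 _ _ hk
    set v := kuhnVertex u τ k
    by_cases h0 : v j = 0
    · have : pt v j = 0 := by simp [pt, h0]
      rw [this]
      exact (hmaps (hpt v)).1 j
    · have : ¬ f (pt v) j ≤ pt v j := fun h' => h ⟨h0, Or.inr h'⟩
      exact (not_le.1 this).le
  · obtain ⟨k, hk⟩ := hfull n le_rfl
    refine ⟨_, hpt _, hdist k, ?_⟩
    have h := hL3 _ hk j
    set v := kuhnVertex u τ k
    rcases h.2 with h1 | h1
    · have : pt v j = 1 := by simp [pt, h1, hN'.ne']
      rw [this]
      exact (hmaps (hpt v)).2 j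
    · exact h1

/-- **Brouwer's fixed point theorem** for the cube. -/
theorem exists_fixedPoint_cube_fin {n : ℕ} (f : (Fin n → ℝ) → Fin n → ℝ)
    (hf : ContinuousOn f (Set.Icc 0 1)) (hmaps : Set.MapsTo f (Set.Icc 0 1) (Set.Icc 0 1)) :
    ∃ x ∈ Set.Icc (0 : Fin n → ℝ) 1, f x = x := by
  choose p hp a ha b hb using fun N : ℕ =>
    (by
      obtain ⟨p, hp, h⟩ := exists_approx_fixedPoint_cube f hmaps (N + 1) N.succ_pos
      choose h1 h2 using h
      choose a ha using h1
      choose b hb using h2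
      exact ⟨p, hp, a, ha, b, hb⟩ :
      ∃ p ∈ Set.Icc (0 : Fin n → ℝ) 1, ∃ a : Fin n → Fin n → ℝ,
        ∃ _ : ∀ j, a j ∈ Set.Icc (0 : Fin n → ℝ) 1 ∧
          dist (a j) p ≤ 1 / (N + 1 : ℕ) ∧ a j j ≤ f (a j) j, ∃ b : Fin n → Fin n → ℝ,
        ∀ j, b j ∈ Set.Icc (0 : Fin n → ℝ) 1 ∧
          dist (b j) p ≤ 1 / (N + 1 : ℕ) ∧ f (b j) j ≤ b j j)
  obtain ⟨x, hx, φ, hφ, hlim⟩ := isCompact_Icc.tendsto_subseq hp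
  have hz : Tendsto (fun N : ℕ => (1 : ℝ) / ((φ N + 1 : ℕ) : ℝ)) atTop (𝓝 0) := by
    have := (tendsto_one_div_add_atTop_nhds_zero_nat (𝕜 := ℝ)).comp hφ.tendsto_atTop
    refine this.congr fun N => ?_
    simp
  have key : ∀ c : ℕ → Fin n → ℝ, (∀ N, c N ∈ Set.Icc (0 : Fin n → ℝ) 1) →
      (∀ N, dist (c N) (p N) ≤ 1 / (N + 1 : ℕ)) →
      Tendsto (fun N => c (φ N)) atTop (𝓝 x) ∧ Tendsto (fun N => f (c (φ N))) atTop (𝓝 (f x)) := by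
    intro c hc hcd
    have h1 : Tendsto (fun N => c (φ N)) atTop (𝓝 x) := by
      refine hlim.congr_dist (squeeze_zero (fun _ => dist_nonneg) (fun N => ?_) hz)
      rw [dist_comm]
      exact hcd (φ N)
    exact ⟨h1, (hf x hx).tendsto.comp
      (tendsto_nhdsWithin_iff.2 ⟨h1, Eventually.of_forall fun N => hc (φ N)⟩)⟩
  refine ⟨x, hx, funext fun j => le_antisymm ?_ ?_⟩
  · obtain ⟨h1, h2⟩ := key (fun N => b N j) (fun N => (hb N j).1) (fun N => (hb N j).2.1)
    exact le_of_tendsto_of_tendsto' ((tendsto_pi_nhds.1 h2) j) ((tendsto_pi_nhds.1 h1) j)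
      fun N => (hb (φ N) j).2.2
  · obtain ⟨h1, h2⟩ := key (fun N => a N j) (fun N => (ha N j).1) (fun N => (ha N j).2.1)
    exact le_of_tendsto_of_tendsto' ((tendsto_pi_nhds.1 h1) j) ((tendsto_pi_nhds.1 h2) j)
      fun N => (ha (φ N) j).2.2

theorem exists_fixedPoint_cube {ι : Type*} [Fintype ι] (f : (ι → ℝ) → ι → ℝ)
    (hf : ContinuousOn f (Set.Icc 0 1)) (hmaps : Set.MapsTo f (Set.Icc 0 1) (Set.Icc 0 1)) :
    ∃ x ∈ Set.Icc (0 : ι → ℝ) 1, f x = x := by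
  let e := Fintype.equivFin ι
  have hto : ∀ z ∈ Set.Icc (0 : Fin (Fintype.card ι) → ℝ) 1,
      (fun i => z (e i)) ∈ Set.Icc (0 : ι → ℝ) 1 := fun z hz =>
    ⟨fun i => hz.1 (e i), fun i => hz.2 (e i)⟩
  obtain ⟨x, hx, hfx⟩ := exists_fixedPoint_cube_fin
    (fun z k => f (fun i => z (e i)) (e.symm k)) (by
      refine continuousOn_pi.2 fun k => ?_
      exact (continuousOn_pi.1 hf (e.symm k)).comp
        (Continuous.continuousOn (by fun_prop)) hto) (by
      intro z hz
      exact ⟨fun k => (hmaps (hto z hz)).1 (e.symm k), fun k => (hmaps (hto z hz)).2 (e.symm k)⟩)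
  refine ⟨fun i => x (e i), hto x hx, funext fun i => ?_⟩
  have := congrFun hfx (e i)
  simpa using this

/-! ### Hölder's and Young's inequalities -/

/-- Hölder's inequality for three factors, as needed for Young's inequality. -/
theorem ENNReal.tsum_mul_pow_pow_le {S : Type*} (f g : S → ℝ≥0∞) (d : ℕ) (hd : 1 ≤ d) :
    (∑' j, f j * g j ^ d) ^ (d + 1)
      ≤ (∑' j, f j ^ (((d : ℝ) + 1) / 2) * g j ^ (d + 1)) * (∑' j, f j ^ (((d : ℝ) + 1) / 2))
        * (∑' j, g j ^ (d + 1)) ^ (d - 1) := by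
  let _ : MeasurableSpace S := ⊤
  have hd' : (1 : ℝ) ≤ d := by exact_mod_cast hd
  have hd0 : (0 : ℝ) < (d : ℝ) + 1 := by linarith
  -- With `p = (d + 1) / 2`, `f g ^ d` is the product of `f ^ p g ^ (d+1)`, `f ^ p` and `g ^ (d+1)`
  -- raised to these exponents, which sum to 1.
  let F : Fin 3 → S → ℝ≥0∞ := ![fun j => f j ^ (((d : ℝ) + 1) / 2) * g j ^ (d + 1),
    fun j => f j ^ (((d : ℝ) + 1) / 2), fun j => g j ^ (d + 1)]
  let e : Fin 3 → ℝ := ![1 / ((d : ℝ) + 1), 1 / ((d : ℝ) + 1), ((d : ℝ) - 1) / ((d : ℝ) + 1)]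
  have h := ENNReal.lintegral_prod_norm_pow_le (μ := MeasureTheory.Measure.count)
    (Finset.univ : Finset (Fin 3)) (f := F) (fun i _ => measurable_from_top.aemeasurable) (p := e)
    (by simp only [Fin.sum_univ_three, e, Matrix.cons_val]; field_simp; ring)
    (by
      intro i _
      fin_cases i <;> simp only [e] <;> first | positivity | exact div_nonneg (by linarith) hd0.le)
  simp only [MeasureTheory.lintegral_count, Fin.prod_univ_three, F, e, Matrix.cons_val] at h
  have hprod : ∀ j, (f j ^ (((d : ℝ) + 1) / 2) * g j ^ (d + 1)) ^ (1 / ((d : ℝ) + 1))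
      * (f j ^ (((d : ℝ) + 1) / 2)) ^ (1 / ((d : ℝ) + 1))
      * (g j ^ (d + 1)) ^ (((d : ℝ) - 1) / ((d : ℝ) + 1)) = f j * g j ^ d := by
    intro j
    rw [ENNReal.mul_rpow_of_nonneg _ _ (by positivity), ← ENNReal.rpow_mul,
      ← ENNReal.rpow_natCast (g j) (d + 1), ← ENNReal.rpow_mul, ← ENNReal.rpow_mul]
    have e1 : ((d : ℝ) + 1) / 2 * (1 / ((d : ℝ) + 1)) = 1 / 2 := by field_simp
    have e2 : ((d + 1 : ℕ) : ℝ) * (1 / ((d : ℝ) + 1)) = 1 := by push_cast; field_simp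
    have e3 : ((d + 1 : ℕ) : ℝ) * (((d : ℝ) - 1) / ((d : ℝ) + 1)) = (d - 1 : ℕ) := by
      push_cast [hd]; field_simp
    rw [e1, e2, e3, ENNReal.rpow_one, ENNReal.rpow_natCast]
    have e4 : f j ^ (1 / 2 : ℝ) * f j ^ (1 / 2 : ℝ) = f j := by
      rw [← ENNReal.rpow_add_of_nonneg _ _ (by norm_num) (by norm_num)]
      norm_num
    have e5 : g j * g j ^ (d - 1) = g j ^ d := by
      rw [← pow_succ', Nat.sub_add_cancel hd]
    calc _ = (f j ^ (1 / 2 : ℝ) * f j ^ (1 / 2 : ℝ)) * (g j * g j ^ (d - 1)) := by ring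
      _ = _ := by rw [e4, e5]
  simp only [hprod] at h
  calc (∑' j, f j * g j ^ d) ^ (d + 1) ≤ _ := pow_le_pow_left₀ zero_le h _
    _ = _ := by
      rw [mul_pow, mul_pow]
      simp only [← ENNReal.rpow_natCast, ← ENNReal.rpow_mul]
      have e1 : 1 / ((d : ℝ) + 1) * ((d + 1 : ℕ) : ℝ) = 1 := by push_cast; field_simp
      have e3 : (((d : ℝ) - 1) / ((d : ℝ) + 1)) * ((d + 1 : ℕ) : ℝ) = (d - 1 : ℕ) := by
        push_cast [hd]; field_simp
      rw [e1, e3, ENNReal.rpow_one, ENNReal.rpow_one]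

/-- **Young's inequality** for `ℓ ^ ((d + 1) / 2) * ℓ ^ ((d + 1) / d) ⊆ ℓ ^ (d + 1)`. -/
theorem ENNReal.tsum_conv_pow_le {S : Type*} [AddCommGroup S] (f g : S → ℝ≥0∞) (d : ℕ)
    (hd : 1 ≤ d) :
    ∑' i, (∑' j, f (i - j) * g j ^ d) ^ (d + 1)
      ≤ (∑' j, f j ^ (((d : ℝ) + 1) / 2)) ^ 2 * (∑' j, g j ^ (d + 1)) ^ d := by
  have hsub : ∀ i, ∑' j, f (i - j) ^ (((d : ℝ) + 1) / 2) = ∑' j, f j ^ (((d : ℝ) + 1) / 2) :=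
    fun i => (Equiv.subLeft i).tsum_eq fun j => f j ^ (((d : ℝ) + 1) / 2)
  have hsub' : ∀ j, ∑' i, f (i - j) ^ (((d : ℝ) + 1) / 2) = ∑' j, f j ^ (((d : ℝ) + 1) / 2) :=
    fun j => (Equiv.subRight j).tsum_eq fun j => f j ^ (((d : ℝ) + 1) / 2)
  calc _ ≤ ∑' i, (∑' j, f (i - j) ^ (((d : ℝ) + 1) / 2) * g j ^ (d + 1))
        * (∑' j, f j ^ (((d : ℝ) + 1) / 2)) * (∑' j, g j ^ (d + 1)) ^ (d - 1) := by
        refine ENNReal.tsum_le_tsum fun i => ?_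
        rw [← hsub i]
        exact ENNReal.tsum_mul_pow_pow_le _ _ d hd
    _ = (∑' j, f j ^ (((d : ℝ) + 1) / 2)) ^ 2 * (∑' j, g j ^ (d + 1)) ^ d := by
        -- Only the first factor still depends on `i`; exchanging the sums and translation
        -- invariance evaluate it.
        rw [ENNReal.tsum_mul_right, ENNReal.tsum_mul_right, ENNReal.tsum_comm]
        simp only [ENNReal.tsum_mul_right, hsub', ENNReal.tsum_mul_left]
        obtain ⟨k, rfl⟩ := Nat.exists_eq_add_of_le' hd
        simp only [Nat.add_sub_cancel]
        ring

theorem ofReal_tsum_rpow {S : Type*} {f : S → ℝ} (hf : ∀ i, 0 ≤ f i) {p : ℝ} (hp : 0 ≤ p)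
    (hs : Summable fun i => f i ^ p) :
    ∑' i, ENNReal.ofReal (f i) ^ p = ENNReal.ofReal (∑' i, f i ^ p) := by
  rw [ENNReal.ofReal_tsum_of_nonneg (fun i => Real.rpow_nonneg (hf i) p) hs]
  exact tsum_congr fun i => ENNReal.ofReal_rpow_of_nonneg (hf i) hp

theorem ofReal_tsum_pow {S : Type*} {f : S → ℝ} (hf : ∀ i, 0 ≤ f i) {p : ℕ}
    (hs : Summable fun i => f i ^ p) :
    ∑' i, ENNReal.ofReal (f i) ^ p = ENNReal.ofReal (∑' i, f i ^ p) := by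
  rw [ENNReal.ofReal_tsum_of_nonneg (fun i => pow_nonneg (hf i) p) hs]
  exact tsum_congr fun i => (ENNReal.ofReal_pow (hf i) p).symm

theorem ofReal_mul_pow {a b : ℝ} (ha : 0 ≤ a) (hb : 0 ≤ b) (d : ℕ) :
    ENNReal.ofReal (a * b ^ d) = ENNReal.ofReal a * ENNReal.ofReal b ^ d := by
  rw [ENNReal.ofReal_mul ha, ENNReal.ofReal_pow hb]

theorem summable_of_tsum_ofReal_ne_top {S : Type*} {f : S → ℝ} (hf : ∀ i, 0 ≤ f i)
    (h : ∑' i, ENNReal.ofReal (f i) ≠ ∞) : Summable f := by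
  have := ENNReal.summable_toReal h
  exact this.congr fun i => ENNReal.toReal_ofReal (hf i)

/-- Summability of a product and Hölder's bound, when one factor is at most `1`. -/
theorem summable_mul_pow_and_tsum_pow_le {S : Type*} {f g : S → ℝ} {d : ℕ} (hd : 1 ≤ d)
    (hf : ∀ i, 0 ≤ f i) (hg : ∀ i, 0 ≤ g i) (hg1 : ∀ i, g i ≤ 1)
    (hfs : Summable fun i => f i ^ (((d : ℝ) + 1) / 2)) (hgs : Summable fun i => g i ^ (d + 1)) :
    (Summable fun j => f j * g j ^ d) ∧
      (∑' j, f j * g j ^ d) ^ (d + 1)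
        ≤ (∑' j, f j ^ (((d : ℝ) + 1) / 2)) ^ 2 * (∑' j, g j ^ (d + 1)) ^ (d - 1) := by
  have h := ENNReal.tsum_mul_pow_pow_le (fun j => ENNReal.ofReal (f j))
    (fun j => ENNReal.ofReal (g j)) d hd
  have hnn : ∀ j, 0 ≤ f j * g j ^ d := fun j => mul_nonneg (hf j) (pow_nonneg (hg j) d)
  have h1 : ∑' j, ENNReal.ofReal (f j) ^ (((d : ℝ) + 1) / 2) * ENNReal.ofReal (g j) ^ (d + 1)
      ≤ ∑' j, ENNReal.ofReal (f j) ^ (((d : ℝ) + 1) / 2) := by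
    refine ENNReal.tsum_le_tsum fun j => mul_le_of_le_one_right' ?_
    exact pow_le_one' (ENNReal.ofReal_le_one.2 (hg1 j)) _
  have h2 := h.trans (mul_le_mul_left (mul_le_mul_left h1 _) _)
  rw [ofReal_tsum_rpow hf (by positivity) hfs, ofReal_tsum_pow hg hgs] at h2
  simp only [← ofReal_mul_pow (hf _) (hg _)] at h2
  have hP : 0 ≤ ∑' j, f j ^ (((d : ℝ) + 1) / 2) := tsum_nonneg fun j => Real.rpow_nonneg (hf j) _
  have hX : 0 ≤ ∑' j, g j ^ (d + 1) := tsum_nonneg fun j => pow_nonneg (hg j) _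
  rw [← ENNReal.ofReal_mul hP, ← ENNReal.ofReal_pow hX, ← ENNReal.ofReal_mul (mul_nonneg hP hP)]
    at h2
  have hs : Summable fun j => f j * g j ^ d := by
    refine summable_of_tsum_ofReal_ne_top hnn fun htop => ?_
    rw [htop] at h2
    simp at h2
  refine ⟨hs, ?_⟩
  rw [← ENNReal.ofReal_tsum_of_nonneg hnn hs, ← ENNReal.ofReal_pow (tsum_nonneg hnn),
    ENNReal.ofReal_le_ofReal_iff (by positivity)] at h2
  rwa [sq]

/-- Young's inequality holds in `[0, ∞]` without convergence assumptions, so finiteness of its right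
side yields summability and the real bound together. -/
theorem summable_conv_pow_and_tsum_le {S : Type*} [AddCommGroup S] {f g : S → ℝ} {d : ℕ}
    (hd : 1 ≤ d) (hf : ∀ i, 0 ≤ f i) (hg : ∀ i, 0 ≤ g i) (hg1 : ∀ i, g i ≤ 1)
    (hfs : Summable fun i => f i ^ (((d : ℝ) + 1) / 2)) (hgs : Summable fun i => g i ^ (d + 1)) :
    (Summable fun i => (∑' j, f (i - j) * g j ^ d) ^ (d + 1)) ∧
      ∑' i, (∑' j, f (i - j) * g j ^ d) ^ (d + 1)
        ≤ (∑' j, f j ^ (((d : ℝ) + 1) / 2)) ^ 2 * (∑' j, g j ^ (d + 1)) ^ d := by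
  have h := ENNReal.tsum_conv_pow_le (fun j => ENNReal.ofReal (f j))
    (fun j => ENNReal.ofReal (g j)) d hd
  have hnn : ∀ i j, 0 ≤ f (i - j) * g j ^ d := fun i j => mul_nonneg (hf _) (pow_nonneg (hg j) d)
  have hs : ∀ i, Summable fun j => f (i - j) * g j ^ d := fun i =>
    (summable_mul_pow_and_tsum_pow_le hd (fun j => hf (i - j)) hg hg1
      ((Equiv.subLeft i).summable_iff.2 hfs) hgs).1
  rw [ofReal_tsum_rpow hf (by positivity) hfs, ofReal_tsum_pow hg hgs] at h
  simp only [← ofReal_mul_pow (hf _) (hg _)] at h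
  simp only [← ENNReal.ofReal_tsum_of_nonneg (hnn _) (hs _)] at h
  have hP : 0 ≤ ∑' j, f j ^ (((d : ℝ) + 1) / 2) := tsum_nonneg fun j => Real.rpow_nonneg (hf j) _
  have hX : 0 ≤ ∑' j, g j ^ (d + 1) := tsum_nonneg fun j => pow_nonneg (hg j) _
  simp only [← ENNReal.ofReal_pow (tsum_nonneg (hnn _))] at h
  rw [← ENNReal.ofReal_pow hX, ← ENNReal.ofReal_pow hP, ← ENNReal.ofReal_mul (by positivity)]
    at h
  have hnn' : ∀ i, 0 ≤ (∑' j, f (i - j) * g j ^ d) ^ (d + 1) := fun i =>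
    pow_nonneg (tsum_nonneg (hnn i)) _
  have hs' : Summable fun i => (∑' j, f (i - j) * g j ^ d) ^ (d + 1) := by
    refine summable_of_tsum_ofReal_ne_top hnn' fun htop => ?_
    rw [htop] at h
    simp at h
  refine ⟨hs', ?_⟩
  rwa [← ENNReal.ofReal_tsum_of_nonneg hnn' hs', ENNReal.ofReal_le_ofReal_iff (by positivity)]
    at h

/-! ### Solutions on finite sets -/

/-- Monotonicity and homogeneity of the `ℓ ^ (m+1)` norm, phrased with powers to avoid roots. It
serves to exclude an active rescaling, where the norm of `z` is exactly `r`. -/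
theorem le_mul_of_sum_pow_le {ι : Type*} (s : Finset ι) (z y : ι → ℝ) (m : ℕ) {a b r k : ℝ}
    (ha : 0 ≤ a) (hb : 0 ≤ b) (hk : 0 ≤ k)
    (hz : ∀ i ∈ s, 0 ≤ z i) (hzy : ∀ i ∈ s, a * z i ≤ b * y i)
    (hzs : ∑ i ∈ s, z i ^ (m + 1) = r ^ (m + 1)) (hys : ∑ i ∈ s, y i ^ (m + 1) ≤ k ^ (m + 1)) :
    a * r ≤ b * k := by
  refine le_of_pow_le_pow_left₀ (Nat.succ_ne_zero m) (mul_nonneg hb hk) ?_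
  calc (a * r) ^ (m + 1) = ∑ i ∈ s, (a * z i) ^ (m + 1) := by
        simp only [mul_pow, ← Finset.mul_sum, hzs]
    _ ≤ ∑ i ∈ s, (b * y i) ^ (m + 1) := Finset.sum_le_sum fun i hi =>
        pow_le_pow_left₀ (mul_nonneg ha (hz i hi)) (hzy i hi) _
    _ = b ^ (m + 1) * ∑ i ∈ s, y i ^ (m + 1) := by simp only [mul_pow, ← Finset.mul_sum]
    _ ≤ b ^ (m + 1) * k ^ (m + 1) := mul_le_mul_of_nonneg_left hys (by positivity)
    _ = (b * k) ^ (m + 1) := (mul_pow _ _ _).symm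

/-- The iteration map of the boundary law equation `z = z ^ d + K z ^ d` on a finite set, clipped to
`[l, 1]` on `A` and rescaled to norm at most `r` off `A`. -/
theorem exists_clipped_fixedPoint {ι : Type*} [Fintype ι] (A : Set ι) [DecidablePred (· ∈ A)]
    (K : ι → ι → ℝ) (hK : ∀ i j, 0 ≤ K i j) (d : ℕ) {r l : ℝ} (hr : 0 < r) (hrl : r < l)
    (hl : l < 1) :
    ∃ z : ι → ℝ, (∀ i, 0 ≤ z i ∧ z i ≤ 1) ∧
      (∀ i ∈ A, z i = max l (min 1 (2 * z i - z i ^ d - ∑ j, K i j * z j ^ d))) ∧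
      ∃ s : ℝ, 0 ≤ s ∧ s ≤ 1 ∧ (∀ i ∉ A, z i = s * (z i ^ d + ∑ j, K i j * z j ^ d)) ∧
        ∑ i with i ∉ A, z i ^ (d + 1) ≤ r ^ (d + 1) ∧
        (s < 1 → ∑ i with i ∉ A, z i ^ (d + 1) = r ^ (d + 1)) := by
  let t : (ι → ℝ) → ι → ℝ := fun z i => z i ^ d + ∑ j, K i j * z j ^ d
  let N : (ι → ℝ) → ℝ := fun z => (∑ i with i ∉ A, |t z i| ^ (d + 1)) ^ (1 / ((d : ℝ) + 1))
  -- On `A` the step is `z` plus the residual `z - z ^ d - K z ^ d`, clipped; iterating `z ^ d + K z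
  -- ^ d` would be repelling near `1`. Off `A` it is the radial retraction onto the ball of radius
  -- `r`.
  let f : (ι → ℝ) → ι → ℝ := fun z i =>
    if i ∈ A then max l (min 1 (2 * z i - z i ^ d - ∑ j, K i j * z j ^ d))
    else r / max r (N z) * t z i
  have ht : Continuous t := by fun_prop
  have hN : Continuous N := by
    refine Continuous.rpow_const ?_ fun _ => Or.inr (by positivity)
    fun_prop
  have hmax : ∀ z, 0 < max r (N z) := fun z => lt_max_of_lt_left hr
  have ht0 : ∀ z ∈ Set.Icc (0 : ι → ℝ) 1, ∀ i, 0 ≤ t z i := by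
    intro z hz i
    have h0 : ∀ j, 0 ≤ z j := hz.1
    exact add_nonneg (pow_nonneg (h0 i) d)
      (Finset.sum_nonneg fun j _ => mul_nonneg (hK i j) (pow_nonneg (h0 j) d))
  have hNpow : ∀ z, N z ^ (d + 1) = ∑ i with i ∉ A, |t z i| ^ (d + 1) := by
    intro z
    have h := Real.rpow_inv_natCast_pow (n := d + 1)
      (Finset.sum_nonneg fun i (_ : i ∈ Finset.univ.filter (· ∉ A)) =>
        pow_nonneg (abs_nonneg (t z i)) (d + 1)) (Nat.succ_ne_zero d)
    simp only [N, one_div]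
    push_cast at h
    exact h
  have hN0 : ∀ z, 0 ≤ N z := fun z => Real.rpow_nonneg
    (Finset.sum_nonneg fun i _ => pow_nonneg (abs_nonneg _) _) _
  have htN : ∀ z i, i ∉ A → t z i ≤ N z := by
    intro z i hi
    refine (le_abs_self _).trans ?_
    refine le_of_pow_le_pow_left₀ (Nat.succ_ne_zero d) (hN0 z) ?_
    rw [hNpow]
    exact Finset.single_le_sum (f := fun i => |t z i| ^ (d + 1))
      (fun j _ => pow_nonneg (abs_nonneg _) _) (by simp [hi])
  have hf : Continuous f := by
    refine continuous_pi fun i => ?_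
    by_cases hi : i ∈ A
    · simp only [f, hi, if_true]
      fun_prop
    · simp only [f, hi, if_false]
      have hti : Continuous fun z => t z i := (continuous_apply i).comp ht
      exact (continuous_const.div (continuous_const.max hN) fun z => (hmax z).ne').mul hti
  have hmaps : Set.MapsTo f (Set.Icc 0 1) (Set.Icc 0 1) := by
    intro z hz
    suffices h : ∀ i, 0 ≤ f z i ∧ f z i ≤ 1 from ⟨fun i => (h i).1, fun i => (h i).2⟩
    intro i
    by_cases hi : i ∈ A
    · simp only [f, hi, if_true]
      exact ⟨le_max_of_le_left (hr.trans hrl).le, max_le hl.le (min_le_left _ _)⟩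
    · simp only [f, hi, if_false]
      refine ⟨mul_nonneg (div_nonneg hr.le (hmax z).le) (ht0 z hz i), ?_⟩
      rw [div_mul_eq_mul_div, div_le_one (hmax z)]
      have h1 : t z i ≤ max r (N z) := (htN z i hi).trans (le_max_right _ _)
      have h2 := ht0 z hz i
      nlinarith
  obtain ⟨z, hz, hfz⟩ := exists_fixedPoint_cube f hf.continuousOn hmaps
  have hoff : ∀ i ∉ A, z i = r / max r (N z) * t z i := by
    intro i hi
    have := congrFun hfz i
    simp only [f, hi, if_false] at this
    exact this.symm
  have hsum : ∑ i with i ∉ A, z i ^ (d + 1) = (r / max r (N z)) ^ (d + 1) * N z ^ (d + 1) := by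
    rw [hNpow, Finset.mul_sum]
    refine Finset.sum_congr rfl fun i hi => ?_
    rw [abs_of_nonneg (ht0 z hz i), ← mul_pow, ← hoff i (by simpa using hi)]
  refine ⟨z, fun i => ⟨hz.1 i, hz.2 i⟩, fun i hi => ?_, r / max r (N z),
    div_nonneg hr.le (hmax z).le, (div_le_one (hmax z)).2 (le_max_left _ _), hoff, ?_, ?_⟩
  · have := congrFun hfz i
    simp only [f, hi, if_true] at this
    exact this.symm
  · rw [hsum, ← mul_pow]
    refine pow_le_pow_left₀ (mul_nonneg (div_nonneg hr.le (hmax z).le) (hN0 z)) ?_ _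
    rw [div_mul_eq_mul_div, div_le_iff₀ (hmax z)]
    exact mul_le_mul_of_nonneg_left (le_max_right _ _) hr.le
  · intro hs
    rw [div_lt_one (hmax z), lt_max_iff] at hs
    have h : r < N z := hs.resolve_left (lt_irrefl r)
    rw [hsum, max_eq_right h.le, ← mul_pow, div_mul_cancel₀ _ (hr.trans h).ne']

/-- Solutions of the boundary law equation truncated to a finite set `B`. -/
theorem exists_truncated_solution {S : Type*} [AddCommGroup S] [DecidableEq S] {d n : ℕ}
    (hd : 2 ≤ d) {q : S → ℝ} (hq : ∀ i, 0 ≤ q i)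
    (hqs : Summable fun i => q i ^ (((d : ℝ) + 1) / 2)) {r l : ℝ} (hr : 0 < r) (hrl : r < l)
    (hl : l < 1) (hfl : r - r ^ d < l - l ^ d)
    (hP : (∑' j, q j ^ (((d : ℝ) + 1) / 2)) ^ 2 * (r ^ (d + 1) + n) ^ d ≤ (r - r ^ d) ^ (d + 1))
    (A B : Finset S) (hAB : A ⊆ B) (hA : A.card = n) :
    ∃ x : S → ℝ, (∀ i, 0 ≤ x i ∧ x i ≤ 1) ∧ (∀ i ∈ A, l ≤ x i) ∧
      (∀ F : Finset S, Disjoint F A → ∑ i ∈ F, x i ^ (d + 1) ≤ r ^ (d + 1)) ∧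
      ∀ i ∈ B, x i = x i ^ d + ∑' j, q (i - j) * x j ^ d := by
  obtain ⟨z, hz, hzA, s, hs0, hs1, hzoff, hzr, hzs⟩ := exists_clipped_fixedPoint
    {i : B | (i : S) ∈ A} (fun i j => q (i - j)) (fun i j => hq _) d hr hrl hl
  have hr1 : r < 1 := hrl.trans hl
  let x : S → ℝ := fun i => if h : i ∈ B then z ⟨i, h⟩ else 0
  have hxB : ∀ i : B, x i = z i := fun i => by simp [x]
  have hxout : ∀ i ∉ B, x i = 0 := fun i hi => by simp [x, hi]
  have hx01 : ∀ i, 0 ≤ x i ∧ x i ≤ 1 := by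
    intro i
    by_cases hi : i ∈ B
    · simp only [x, hi, dif_pos]; exact hz _
    · simp [x, hi]
  have hd0 : d ≠ 0 := by omega
  have hy : ∀ i : B, ∑ j : B, q ((i : S) - j) * z j ^ d = ∑' j, q ((i : S) - j) * x j ^ d := by
    intro i
    rw [tsum_eq_sum (s := B) fun j hj => by rw [hxout j hj, zero_pow hd0, mul_zero],
      ← Finset.sum_coe_sort B]
    simp only [hxB]
  simp only [hy] at hzA hzoff
  set y : S → ℝ := fun i => ∑' j, q (i - j) * x j ^ d with hydef
  have hsumB : ∑ i ∈ B \ A, x i ^ (d + 1)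
      = ∑ i : B with i ∉ {i : B | (i : S) ∈ A}, z i ^ (d + 1) := by
    rw [Finset.sum_filter, ← Finset.sum_filter_add_sum_filter_not (B \ A) (fun _ => True)]
    simp only [Finset.filter_true, not_true_eq_false, Finset.filter_false, Finset.sum_empty,
      add_zero]
    rw [Finset.sdiff_eq_filter, Finset.sum_filter, ← Finset.sum_coe_sort B]
    simp only [hxB, Set.mem_ofPred_eq]
  rw [← hsumB] at hzr hzs
  have hoffF : ∀ F : Finset S, Disjoint F A → ∑ i ∈ F, x i ^ (d + 1) ≤ r ^ (d + 1) := by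
    intro F hF
    refine le_trans ?_ hzr
    rw [← Finset.sum_filter_of_ne (s := F) (p := fun i => i ∈ B)]
    · refine Finset.sum_le_sum_of_subset_of_nonneg (fun i hi => ?_) fun i _ _ =>
        pow_nonneg (hx01 i).1 _
      rw [Finset.mem_filter] at hi
      exact Finset.mem_sdiff.2 ⟨hi.2, Finset.disjoint_left.1 hF hi.1⟩
    · intro i _ hne
      by_contra hi
      exact hne (by rw [hxout i hi, zero_pow (Nat.succ_ne_zero d)])
  have hxs : Summable fun i => x i ^ (d + 1) := by
    refine summable_of_ne_finset_zero (s := B) fun i hi => ?_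
    rw [hxout i hi, zero_pow (Nat.succ_ne_zero d)]
  have hX : ∑' i, x i ^ (d + 1) ≤ r ^ (d + 1) + n := by
    rw [tsum_eq_sum (s := B) fun i hi => by rw [hxout i hi, zero_pow (Nat.succ_ne_zero d)],
      ← Finset.sum_sdiff hAB]
    refine add_le_add hzr ?_
    calc ∑ i ∈ A, x i ^ (d + 1) ≤ ∑ i ∈ A, 1 :=
          Finset.sum_le_sum fun i _ => pow_le_one₀ (hx01 i).1 (hx01 i).2
      _ = n := by simp [hA]
  obtain ⟨hys, hyle⟩ := summable_conv_pow_and_tsum_le (by omega : 1 ≤ d) hq (fun i => (hx01 i).1)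
    (fun i => (hx01 i).2) hqs hxs
  have hy0 : ∀ i, 0 ≤ y i := fun i =>
    tsum_nonneg fun j => mul_nonneg (hq _) (pow_nonneg (hx01 j).1 d)
  have hX0 : 0 ≤ ∑' i, x i ^ (d + 1) := tsum_nonneg fun i => pow_nonneg (hx01 i).1 _
  -- Young's inequality with `‖x‖ ^ (d+1) ≤ r ^ (d+1) + n`: the smallness assumption is exactly what
  -- bounds `y` by `r - r ^ d`.
  have hY : ∑' i, y i ^ (d + 1) ≤ (r - r ^ d) ^ (d + 1) :=
    hyle.trans ((mul_le_mul_of_nonneg_left (pow_le_pow_left₀ hX0 hX d) (sq_nonneg _)).trans hP)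
  have hrd : 0 ≤ r - r ^ d := sub_nonneg.2 (pow_le_of_le_one hr.le hr1.le hd0)
  have hysum : ∀ F : Finset S, ∑ i ∈ F, y i ^ (d + 1) ≤ (r - r ^ d) ^ (d + 1) := fun F =>
    (hys.sum_le_tsum F fun i _ => pow_nonneg (hy0 i) _).trans hY
  have hyle : ∀ i, y i ≤ r - r ^ d := fun i =>
    le_of_pow_le_pow_left₀ (Nat.succ_ne_zero d) hrd (by simpa using hysum {i})
  have hxr : ∀ i ∉ A, x i ≤ r := fun i hi =>
    le_of_pow_le_pow_left₀ (Nat.succ_ne_zero d) hr.le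
      (by simpa using hoffF {i} (by simpa using hi))
  -- If the rescaling were active, the norm off `A` would equal `r`, and `x ^ d ≤ r ^ (d-1) x` would
  -- give `(1 - s r ^ (d-1)) r ≤ s (r - r ^ d)`, that is `r ≤ s r`.
  have hs : s = 1 := by
    by_contra hne
    have hslt : s < 1 := lt_of_le_of_ne hs1 hne
    have hrd1 : r ^ (d - 1) ≤ 1 := pow_le_one₀ hr.le hr1.le
    have key := le_mul_of_sum_pow_le (B \ A) x y d (a := 1 - s * r ^ (d - 1)) (b := s)
      (r := r) (k := r - r ^ d)
      (by nlinarith [pow_nonneg hr.le (d - 1)]) hs0 hrd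
      (fun i _ => (hx01 i).1) (by
        intro i hi
        obtain ⟨hiB, hiA⟩ := Finset.mem_sdiff.1 hi
        have h1 : x i = s * (x i ^ d + y i) := by
          have := hzoff ⟨i, hiB⟩ hiA
          rwa [← hxB] at this
        have h2 : x i ^ d = x i ^ (d - 1) * x i := by rw [← pow_succ, Nat.sub_add_cancel (by omega)]
        have h3 : x i ^ (d - 1) ≤ r ^ (d - 1) := pow_le_pow_left₀ (hx01 i).1 (hxr i hiA) _
        have h4 := mul_le_mul_of_nonneg_left
          (mul_le_mul_of_nonneg_right h3 (hx01 i).1) hs0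
        have h5 : s * y i = x i - s * (x i ^ (d - 1) * x i) := by
          rw [← h2]; linear_combination -h1
        rw [h5]
        linarith) (hzs hslt) (hysum _)
    have h2 : r ^ d = r ^ (d - 1) * r := by rw [← pow_succ, Nat.sub_add_cancel (by omega)]
    rw [h2] at key
    nlinarith
  refine ⟨x, hx01, ?_, hoffF, ?_⟩
  · intro i hi
    have := hzA ⟨i, hAB hi⟩ hi
    rw [← hxB] at this
    rw [this]
    exact le_max_left _ _
  · intro i hi
    by_cases hiA : i ∈ A
    · have h := hzA ⟨i, hi⟩ hiA
      rw [← hxB] at h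
      change x i = max l (min 1 (2 * x i - x i ^ d - y i)) at h
      change x i = x i ^ d + y i
      have hyi := hyle i
      have hyi0 := hy0 i
      -- The lower clip would need `y ≥ l - l ^ d`, contradicting `y ≤ r - r ^ d`. The upper clip
      -- gives `x = 1` and `y = 0`, for which the equation holds anyway.
      rcases le_total (2 * x i - x i ^ d - y i) 1 with h1 | h1
      · rw [min_eq_right h1] at h
        rcases le_total l (2 * x i - x i ^ d - y i) with h2 | h2
        · rw [max_eq_right h2] at h
          linarith
        · rw [max_eq_left h2] at h
          rw [h] at h2
          linarith
      · rw [min_eq_left h1, max_eq_right hl.le] at h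
        rw [h] at h1 ⊢
        simp only [one_pow] at h1 ⊢
        linarith
    · have h := hzoff ⟨i, hi⟩ hiA
      rw [← hxB, hs, one_mul] at h
      exact h

/-! ### Passage to the limit -/

/-- On bounded sets of `ℓ ^ (d + 1)` with values in `[0, 1]`, pairing the `d`-th power with a fixed
`ℓ ^ ((d + 1) / 2)` function is continuous for pointwise convergence. -/
theorem tendsto_tsum_mul_pow {α S : Type*} {u : Filter α} {f : S → ℝ} {d : ℕ} (hd : 1 ≤ d)
    (hf : ∀ i, 0 ≤ f i) (hfs : Summable fun i => f i ^ (((d : ℝ) + 1) / 2)) {M : ℝ}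
    {g : α → S → ℝ} {x : S → ℝ} (hg : ∀ a i, 0 ≤ g a i ∧ g a i ≤ 1)
    (hgM : ∀ a (F : Finset S), ∑ i ∈ F, g a i ^ (d + 1) ≤ M)
    (hx : ∀ i, 0 ≤ x i ∧ x i ≤ 1) (hxM : ∀ F : Finset S, ∑ i ∈ F, x i ^ (d + 1) ≤ M)
    (hlim : ∀ i, Tendsto (fun a => g a i) u (𝓝 (x i))) :
    Tendsto (fun a => ∑' j, f j * g a j ^ d) u (𝓝 (∑' j, f j * x j ^ d)) := by
  classical
  set p : ℝ := ((d : ℝ) + 1) / 2 with hp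
  have hp0 : p ≠ 0 := by positivity
  have hM : 0 ≤ M := by simpa using hxM ∅
  -- This Hölder bound on the part of the pairing outside `F` does not depend on `g`, so one finite
  -- set serves for all `g a` and for `x`.
  have htail : Tendsto (fun F : Finset S => (∑' j, (if j ∈ F then 0 else f j) ^ p) ^ 2 * M ^ (d - 1))
      atTop (𝓝 0) := by
    have h1 := tendsto_tsum_compl_atTop_zero fun i => f i ^ p
    have h2 : ∀ F : Finset S, ∑' j, (if j ∈ F then 0 else f j) ^ p
        = ∑' j : {j // j ∉ F}, f j ^ p := by
      intro F
      refine Eq.trans (tsum_congr fun j => ?_) (tsum_subtype {j | j ∉ F} fun j => f j ^ p).symm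
      by_cases hj : j ∈ F <;> simp [hj, Real.zero_rpow hp0]
    simp only [h2]
    simpa using (h1.pow 2).mul_const (M ^ (d - 1))
  have hsplit : ∀ (F : Finset S) (h : S → ℝ), (∀ i, 0 ≤ h i ∧ h i ≤ 1) →
      (∀ F : Finset S, ∑ i ∈ F, h i ^ (d + 1) ≤ M) →
      ∃ e, 0 ≤ e ∧ e ^ (d + 1) ≤ (∑' j, (if j ∈ F then 0 else f j) ^ p) ^ 2 * M ^ (d - 1) ∧
        ∑' j, f j * h j ^ d = ∑ j ∈ F, f j * h j ^ d + e := by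
    intro F h h01 hhM
    have hF0 : ∀ j, 0 ≤ if j ∈ F then 0 else f j := fun j => by
      split_ifs
      · exact le_rfl
      · exact hf j
    have hhs : Summable fun i => h i ^ (d + 1) :=
      summable_of_sum_le (fun i => pow_nonneg (h01 i).1 _) hhM
    have hFs : Summable fun j => (if j ∈ F then 0 else f j) ^ p := by
      refine hfs.of_nonneg_of_le (fun j => Real.rpow_nonneg (hF0 j) p) fun j => ?_
      refine Real.rpow_le_rpow (hF0 j) ?_ (by positivity)
      split_ifs
      · exact hf j
      · exact le_rfl
    obtain ⟨hs, hle⟩ := summable_mul_pow_and_tsum_pow_le hd hF0 (fun i => (h01 i).1)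
      (fun i => (h01 i).2) hFs hhs
    refine ⟨∑' j, (if j ∈ F then 0 else f j) * h j ^ d,
      tsum_nonneg fun j => mul_nonneg (hF0 j) (pow_nonneg (h01 j).1 d), hle.trans ?_, ?_⟩
    · refine mul_le_mul_of_nonneg_left (pow_le_pow_left₀ (tsum_nonneg fun i =>
        pow_nonneg (h01 i).1 _) (hhs.tsum_le_of_sum_le hhM) _) (sq_nonneg _)
    · have h1 : ∑' j, (if j ∈ F then f j * h j ^ d else 0) = ∑ j ∈ F, f j * h j ^ d := by
        rw [tsum_eq_sum (s := F) fun j hj => if_neg hj]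
        exact Finset.sum_congr rfl fun j hj => if_pos hj
      rw [← h1, ← Summable.tsum_add (summable_of_ne_finset_zero (s := F) fun j hj => if_neg hj) hs]
      refine tsum_congr fun j => ?_
      split_ifs <;> simp
  rw [Metric.tendsto_nhds]
  intro ε hε
  obtain ⟨F, hF⟩ := (htail.eventually (gt_mem_nhds (by positivity : 0 < (ε / 3) ^ (d + 1)))).exists
  have hfin : Tendsto (fun a => ∑ j ∈ F, f j * g a j ^ d) u (𝓝 (∑ j ∈ F, f j * x j ^ d)) :=
    tendsto_finsetSum _ fun j _ => ((hlim j).pow d).const_mul _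
  filter_upwards [Metric.tendsto_nhds.1 hfin (ε / 3) (by positivity)] with a ha
  obtain ⟨e, he0, he1, he⟩ := hsplit F (g a) (hg a) (hgM a)
  obtain ⟨e', he0', he1', he'⟩ := hsplit F x hx hxM
  have h1 : e < ε / 3 := lt_of_pow_lt_pow_left₀ (d + 1) (by positivity) (he1.trans_lt hF)
  have h2 : e' < ε / 3 := lt_of_pow_lt_pow_left₀ (d + 1) (by positivity) (he1'.trans_lt hF)
  rw [he, he']
  rw [Real.dist_eq, abs_lt] at ha ⊢
  constructor <;> linarith [ha.1, ha.2]

/-- Existence of a solution of the boundary law equation `x = x ^ d + q * x ^ d` concentrated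
on `A`. -/
theorem exists_boundaryLaw {S : Type*} [AddCommGroup S] {d n : ℕ}
    (hd : 2 ≤ d) {q : S → ℝ} (hq : ∀ i, 0 ≤ q i)
    (hqs : Summable fun i => q i ^ (((d : ℝ) + 1) / 2)) {r l : ℝ} (hr : 0 < r) (hrl : r < l)
    (hl : l < 1) (hfl : r - r ^ d < l - l ^ d)
    (hP : (∑' j, q j ^ (((d : ℝ) + 1) / 2)) ^ 2 * (r ^ (d + 1) + n) ^ d ≤ (r - r ^ d) ^ (d + 1))
    (A : Finset S) (hA : A.card = n) :
    ∃ x : S → ℝ, (∀ i, 0 ≤ x i ∧ x i ≤ 1) ∧ (∀ i ∈ A, l ≤ x i) ∧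
      (∀ F : Finset S, Disjoint F A → ∑ i ∈ F, x i ^ (d + 1) ≤ r ^ (d + 1)) ∧
      ∀ i, x i = x i ^ d + ∑' j, q (i - j) * x j ^ d := by
  classical
  choose g hg01 hgA hgF hgB using fun B : Finset S =>
    exists_truncated_solution hd hq hqs hr hrl hl hfl hP A (A ∪ B) Finset.subset_union_left hA
  have hbound : ∀ h : S → ℝ, (∀ i, 0 ≤ h i ∧ h i ≤ 1) →
      (∀ F : Finset S, Disjoint F A → ∑ i ∈ F, h i ^ (d + 1) ≤ r ^ (d + 1)) →
      ∀ F : Finset S, ∑ i ∈ F, h i ^ (d + 1) ≤ r ^ (d + 1) + n := by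
    intro h h01 hF F
    rw [← Finset.sum_sdiff (Finset.inter_subset_left : F ∩ A ⊆ F)]
    refine add_le_add (hF _ ?_) ?_
    · rw [Finset.sdiff_inter_self_left]
      exact Finset.sdiff_disjoint
    · calc ∑ i ∈ F ∩ A, h i ^ (d + 1) ≤ ∑ i ∈ F ∩ A, 1 :=
            Finset.sum_le_sum fun i _ => pow_le_one₀ (h01 i).1 (h01 i).2
        _ ≤ n := by
          rw [Finset.sum_const, nsmul_one, ← hA]
          exact_mod_cast Finset.card_le_card Finset.inter_subset_right
  -- Compactness of `[0, 1]` makes every coordinate converge along one ultrafilter, which replaces a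
  -- diagonal extraction.
  let U : Ultrafilter (Finset S) := Ultrafilter.of atTop
  have hU : (U : Filter (Finset S)) ≤ atTop := Ultrafilter.of_le _
  have hcomp : ∀ i, ∃ y ∈ Set.Icc (0 : ℝ) 1, Tendsto (fun B => g B i) U (𝓝 y) := by
    intro i
    refine isCompact_iff_ultrafilter_le_nhds.1 isCompact_Icc (U.map fun B => g B i) ?_
    rw [le_principal_iff]
    exact Filter.mem_map.2 (Filter.univ_mem' fun B => hg01 B i)
  choose x hx hlim using hcomp
  have hxF : ∀ F : Finset S, Disjoint F A → ∑ i ∈ F, x i ^ (d + 1) ≤ r ^ (d + 1) := fun F hF =>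
    le_of_tendsto' (tendsto_finsetSum F fun i _ => (hlim i).pow (d + 1)) fun B => hgF B F hF
  refine ⟨x, hx, fun i hi => ge_of_tendsto' (hlim i) fun B => hgA B i hi, hxF, fun i => ?_⟩
  have h1 : Tendsto (fun B => g B i ^ d + ∑' j, q (i - j) * g B j ^ d) U
      (𝓝 (x i ^ d + ∑' j, q (i - j) * x j ^ d)) :=
    ((hlim i).pow d).add (tendsto_tsum_mul_pow (by omega) (fun j => hq (i - j))
      ((Equiv.subLeft i).summable_iff.2 hqs) hg01 (fun B => hbound _ (hg01 B) (hgF B)) hx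
      (hbound x hx hxF) hlim)
  refine tendsto_nhds_unique (hlim i) (h1.congr' ?_)
  filter_upwards [hU (eventually_ge_atTop {i})] with B hB
  exact (hgB B i (Finset.mem_union_right _ (hB (Finset.mem_singleton_self i)))).symm

/-! ### The constants `λ_d`, `ρ` and `η` -/

theorem lam_pos {d : ℕ} (hd : 2 ≤ d) : 0 < lam d :=
  Real.rpow_pos_of_pos (by positivity) _

theorem natCast_mul_lam_pow {d : ℕ} (hd : 2 ≤ d) : (d : ℝ) * lam d ^ (d - 1) = 1 := by
  have hd' : (2 : ℝ) ≤ d := by exact_mod_cast hd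
  have hd1 : (d : ℝ) - 1 ≠ 0 := by linarith
  rw [lam, ← Real.rpow_natCast, ← Real.rpow_mul (by positivity)]
  have : -(1 / ((d : ℝ) - 1)) * ((d - 1 : ℕ) : ℝ) = -1 := by
    push_cast [(by omega : 1 ≤ d)]
    field_simp
  rw [this, Real.rpow_neg_one]
  exact mul_inv_cancel₀ (by positivity)

theorem lam_lt_one {d : ℕ} (hd : 2 ≤ d) : lam d < 1 := by
  have hd' : (2 : ℝ) ≤ d := by exact_mod_cast hd
  by_contra! h
  have h1 := one_le_pow₀ h (n := d - 1)
  have h2 := natCast_mul_lam_pow hd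
  nlinarith

theorem natCast_mul_lam_pow_self {d : ℕ} (hd : 2 ≤ d) : (d : ℝ) * lam d ^ d = lam d := by
  have h := natCast_mul_lam_pow hd
  obtain ⟨k, rfl⟩ := Nat.exists_eq_add_of_le' (by omega : 1 ≤ d)
  rw [Nat.add_sub_cancel] at h
  rw [pow_succ, ← mul_assoc, h, one_mul]

theorem pow_sub_pow_lt_mul_sub {a b : ℝ} (ha : 0 ≤ a) (hab : a < b) {k : ℕ} (hk : 2 ≤ k) :
    b ^ k - a ^ k < k * b ^ (k - 1) * (b - a) := by
  induction k, hk using Nat.le_induction with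
  | base => norm_num; nlinarith
  | succ k hk ih =>
    obtain ⟨m, rfl⟩ := Nat.exists_eq_add_of_le' (by omega : 1 ≤ k)
    have hb : 0 < b := ha.trans_lt hab
    simp only [Nat.add_sub_cancel] at ih ⊢
    have h1 : a ^ (m + 1) ≤ b ^ (m + 1) := pow_le_pow_left₀ ha hab.le _
    have h2 := mul_lt_mul_of_pos_left ih hb
    have h3 := mul_le_mul_of_nonneg_right h1 (sub_nonneg.2 hab.le)
    push_cast at h2 h3 ⊢
    calc b ^ (m + 1 + 1) - a ^ (m + 1 + 1)
        = b * (b ^ (m + 1) - a ^ (m + 1)) + a ^ (m + 1) * (b - a) := by ring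
      _ < b * (((m : ℝ) + 1) * b ^ m * (b - a)) + b ^ (m + 1) * (b - a) := by linarith
      _ = _ := by ring

/-- `λ_d` is the critical point of `t - t ^ d`, since `d λ_d ^ (d-1) = 1`; the strict mean value
estimate at `λ_d` then gives the claim. -/
theorem sub_pow_lt_lam {d : ℕ} (hd : 2 ≤ d) {r : ℝ} (hr : 0 ≤ r) (hrl : r < lam d) :
    r - r ^ d < lam d - lam d ^ d := by
  have h := pow_sub_pow_lt_mul_sub hr hrl hd
  rw [natCast_mul_lam_pow hd, one_mul] at h
  linarith

/-- Concavity of `x - x ^ d` between `a` and `1`. -/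
theorem one_sub_mul_sub_pow_le {d : ℕ} {a x : ℝ} (ha : 0 ≤ a) (ha1 : a < 1) (hax : a ≤ x)
    (hx1 : x ≤ 1) : (1 - x) * (a - a ^ d) ≤ (1 - a) * (x - x ^ d) := by
  have h1 : 0 < 1 - a := sub_pos.2 ha1
  have h := (convexOn_pow d).2 (Set.mem_Ici.2 ha) (Set.mem_Ici.2 zero_le_one)
    (div_nonneg (sub_nonneg.2 hx1) h1.le) (div_nonneg (sub_nonneg.2 hax) h1.le)
    (by field_simp; ring)
  simp only [smul_eq_mul, one_pow, mul_one] at h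
  have e : (1 - x) / (1 - a) * a + (x - a) / (1 - a) = x := by field_simp; ring
  rw [e, ← mul_le_mul_iff_of_pos_left h1] at h
  have e2 : (1 - a) * ((1 - x) / (1 - a) * a ^ d + (x - a) / (1 - a))
      = (1 - x) * a ^ d + (x - a) := by field_simp
  rw [e2] at h
  linarith

/-- Identifies the constant of the second estimate as `(1 - λ_d) / (λ_d - λ_d ^ d)`, the inverse
slope, up to sign, of the chord of `t - t ^ d` over `[λ_d, 1]`. -/
theorem const_mul_lam_sub_pow {d : ℕ} (hd : 2 ≤ d) :
    ((d : ℝ) ^ ((d : ℝ) / ((d : ℝ) - 1)) - d) / ((d : ℝ) - 1) * (lam d - lam d ^ d)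
      = 1 - lam d := by
  have hd' : (2 : ℝ) ≤ d := by exact_mod_cast hd
  have hd1 : (d : ℝ) - 1 ≠ 0 := by linarith
  have hd0 : (0 : ℝ) < d := by linarith
  have h1 : (d : ℝ) ^ ((d : ℝ) / ((d : ℝ) - 1)) = d * (lam d)⁻¹ := by
    rw [lam, ← Real.rpow_neg hd0.le, neg_neg]
    rw [mul_comm, ← Real.rpow_add_one hd0.ne']
    congr 1
    field_simp
    ring
  have h2 : lam d ^ d = lam d / d := by
    rw [eq_div_iff hd0.ne', mul_comm, natCast_mul_lam_pow_self hd]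
  have h3 := (lam_pos hd).ne'
  rw [h1, h2]
  field_simp

theorem rho_mem {d n : ℕ} (hd : 2 ≤ d) (hn : 1 ≤ n) : rho d n ∈ rhoRoots d n := by
  rw [rho_spec d n hd hn]
  rfl

theorem rho_pos {d n : ℕ} (hd : 2 ≤ d) (hn : 1 ≤ n) : 0 < rho d n := (rho_mem hd hn).1

/-- If `ρ ≥ λ_d`, then `d ρ ^ (d-1) ≥ 1`, and the left side of the equation for `ρ` is positive.
That equation says that `ρ` is a critical point of `(r - r ^ d) / (r ^ (d+1) + n) ^ (d/(d+1))`, but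
only `0 < ρ < λ_d` is needed below. -/
theorem rho_lt_lam {d n : ℕ} (hd : 2 ≤ d) (hn : 1 ≤ n) : rho d n < lam d := by
  have hd' : (2 : ℝ) ≤ d := by exact_mod_cast hd
  have hn' : (1 : ℝ) ≤ n := by exact_mod_cast hn
  obtain ⟨h0, h1⟩ := rho_mem hd hn
  by_contra! h
  have h2 := pow_le_pow_left₀ (lam_pos hd).le h (d - 1)
  have h3 := natCast_mul_lam_pow hd
  have h4 : 1 ≤ (d : ℝ) * rho d n ^ (d - 1) := by
    rw [← h3]
    exact mul_le_mul_of_nonneg_left h2 (by linarith)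
  have h5 : 0 < ((d : ℝ) - 1) * rho d n ^ (d + 1) := mul_pos (by linarith) (by positivity)
  nlinarith

theorem rho_lt_one {d n : ℕ} (hd : 2 ≤ d) (hn : 1 ≤ n) : rho d n < 1 :=
  (rho_lt_lam hd hn).trans (lam_lt_one hd)

theorem rho_sub_pow {d n : ℕ} (hd : 2 ≤ d) :
    rho d n - rho d n ^ d = (1 - rho d n ^ (d - 1)) * rho d n := by
  obtain ⟨k, rfl⟩ := Nat.exists_eq_add_of_le' (by omega : 1 ≤ d)
  rw [Nat.add_sub_cancel]
  ring

theorem one_sub_rho_pow_pos {d n : ℕ} (hd : 2 ≤ d) (hn : 1 ≤ n) :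
    0 < 1 - rho d n ^ (d - 1) :=
  sub_pos.2 (pow_lt_one₀ (rho_pos hd hn).le (rho_lt_one hd hn) (by omega))

theorem rho_sub_pow_pos {d n : ℕ} (hd : 2 ≤ d) (hn : 1 ≤ n) : 0 < rho d n - rho d n ^ d := by
  rw [rho_sub_pow hd]
  exact mul_pos (one_sub_rho_pow_pos hd hn) (rho_pos hd hn)

theorem rho_pow_add_pos {d n : ℕ} (hd : 2 ≤ d) (hn : 1 ≤ n) : 0 < rho d n ^ (d + 1) + n :=
  add_pos_of_pos_of_nonneg (pow_pos (rho_pos hd hn) _) n.cast_nonneg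

theorem eta_pos {d n : ℕ} (hd : 2 ≤ d) (hn : 1 ≤ n) : 0 < eta d n :=
  div_pos (rho_sub_pow_pos hd hn) (Real.rpow_pos_of_pos (rho_pow_add_pos hd hn) _)

theorem eta_mul {d n : ℕ} (hd : 2 ≤ d) (hn : 1 ≤ n) :
    eta d n * (rho d n ^ (d + 1) + n) ^ ((d : ℝ) / ((d : ℝ) + 1)) = rho d n - rho d n ^ d :=
  div_mul_cancel₀ _ (Real.rpow_pos_of_pos (rho_pow_add_pos hd hn) _).ne'

theorem mul_rpow_pow_succ {K X : ℝ} (hX : 0 ≤ X) (d : ℕ) :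
    (K * X ^ ((d : ℝ) / ((d : ℝ) + 1))) ^ (d + 1) = K ^ (d + 1) * X ^ d := by
  rw [mul_pow, ← Real.rpow_natCast (X ^ _), ← Real.rpow_mul hX]
  congr 1
  rw [← Real.rpow_natCast]
  congr 1
  push_cast
  field_simp

/-! ### Norms of restrictions and the identity part of the convolution -/

theorem toReal_natCast_add_one (d : ℕ) : ((d : ℝ≥0∞) + 1).toReal = (d : ℝ) + 1 := by
  rw [ENNReal.toReal_add (by simp) (by simp)]
  simp

theorem toReal_natCast_add_one_div_two (d : ℕ) :
    (((d : ℝ≥0∞) + 1) / 2).toReal = ((d : ℝ) + 1) / 2 := by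
  rw [ENNReal.toReal_div, toReal_natCast_add_one]
  simp

theorem norm_lpRestrict_compl_le {S : Type*} {d : ℕ} (A : Finset S)
    (x : lp (fun _ : S => ℝ) ((d : ℝ≥0∞) + 1)) {C : ℝ} (hC : 0 ≤ C)
    (h : ∀ F : Finset S, Disjoint F A → ∑ i ∈ F, |x i| ^ (d + 1) ≤ C ^ (d + 1)) :
    ‖lpRestrict ((A : Set S)ᶜ) (le_refl ((d : ℝ≥0∞) + 1)) x‖ ≤ C := by
  have hp : 0 < ((d : ℝ≥0∞) + 1).toReal := by rw [toReal_natCast_add_one]; positivity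
  have hcast : ∀ a : ℝ, a ^ ((d : ℝ≥0∞) + 1).toReal = a ^ (d + 1) := by
    intro a
    rw [toReal_natCast_add_one, ← Real.rpow_natCast]
    push_cast
    rfl
  refine lp.norm_le_of_forall_sum_le hp hC fun s => ?_
  have h1 := h (s.map (Function.Embedding.subtype _)) (by
    rw [Finset.disjoint_left]
    intro i hi
    obtain ⟨j, _, rfl⟩ := Finset.mem_map.1 hi
    exact fun hj => j.2 hj)
  rw [Finset.sum_map] at h1
  simp only [hcast]
  exact h1

theorem norm_lpRestrict_top_le {S : Type*} {d : ℕ} (B : Set S)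
    (x : lp (fun _ : S => ℝ) ((d : ℝ≥0∞) + 1)) :
    ‖lpRestrict B (le_top : (d : ℝ≥0∞) + 1 ≤ ∞) x‖
      ≤ ‖lpRestrict B (le_refl ((d : ℝ≥0∞) + 1)) x‖ := by
  refine lp.norm_le_of_forall_le (lp.norm_nonneg' _) fun i => ?_
  exact lp.norm_apply_le_norm (by simp) (lpRestrict B (le_refl ((d : ℝ≥0∞) + 1)) x) i

theorem tsum_conv_eq {S : Type*} [AddCommGroup S] [DecidableEq S] {q g : S → ℝ} (i : S)
    (hs : Summable fun j => q (i - j) * g j) :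
    (Summable fun j => (q (i - j) + if i - j = 0 then 1 else 0) * g j) ∧
      ∑' j, (q (i - j) + if i - j = 0 then 1 else 0) * g j
        = g i + ∑' j, q (i - j) * g j := by
  have h1 : ∀ j, (q (i - j) + if i - j = 0 then 1 else 0) * g j
      = (if j = i then g i else 0) + q (i - j) * g j := by
    intro j
    by_cases h : j = i
    · subst h; simp; ring
    · have h' : i - j ≠ 0 := fun h0 => h (sub_eq_zero.1 h0).symm
      simp [h, h']
  simp only [h1]
  have h2 : Summable fun j => if j = i then g i else 0 :=
    summable_of_ne_finset_zero (s := {i}) fun j hj => if_neg (by simpa using hj)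
  exact ⟨h2.add hs, by rw [h2.tsum_add hs, tsum_ite_eq]⟩

/-! ### The existence proposition -/

theorem mainTheorem2 {S : Type*} [AddCommGroup S] [Countable S] [Nontrivial S] [DecidableEq S]
    (d n : ℕ) (hd : 2 ≤ d) (hn : 1 ≤ n)
    (Q : lp (fun _ : S => ℝ) (((d : ℝ≥0∞) + 1) / 2))
    (hQpos : ∀ i, 0 < Q i) (hQ0 : Q 0 = 1)
    (hQ : ‖Q - lp.single (((d : ℝ≥0∞) + 1) / 2) (0 : S) (1 : ℝ)‖ ≤ eta d n)
    (A : Finset S) (hA : A.card = n) :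
    ∃ x : lp (fun _ : S => ℝ) ((d : ℝ≥0∞) + 1),
      -- `x` is a positive solution of `x = Q * x ^ d`, the convolution converging everywhere
      (∀ i, 0 < x i) ∧
      (∀ i, Summable fun j => Q (i - j) * x j ^ d) ∧
      (∀ i, x i = groupConv (fun j => Q j) (fun j => x j ^ d) i) ∧
      -- concentration on `A`
      ‖lpRestrict ((A : Set S)ᶜ) (le_top : (d : ℝ≥0∞) + 1 ≤ ∞) x‖
        ≤ ‖lpRestrict ((A : Set S)ᶜ) (le_refl ((d : ℝ≥0∞) + 1)) x‖ ∧
      ‖lpRestrict ((A : Set S)ᶜ) (le_refl ((d : ℝ≥0∞) + 1)) x‖ < rho d n ∧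
      rho d n < lam d ∧
      (∀ i ∈ A, lam d < x i ∧ x i < 1) ∧
      -- smallness off `A`, linear in the norm of `Q - 1_{0}`
      ‖lpRestrict ((A : Set S)ᶜ) (le_refl ((d : ℝ≥0∞) + 1)) x‖
        ≤ rho d n / eta d n * ‖Q - lp.single (((d : ℝ≥0∞) + 1) / 2) (0 : S) (1 : ℝ)‖ ∧
      -- closeness to `1` on `A`
      (∀ i ∈ A, 0 < 1 - x i ∧
        1 - x i ≤ ((d : ℝ) ^ ((d : ℝ) / ((d : ℝ) - 1)) - d) / ((d : ℝ) - 1)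
          * (1 + (n : ℝ)) ^ ((d : ℝ) / ((d : ℝ) + 1))
          * ‖Q - lp.single (((d : ℝ≥0∞) + 1) / 2) (0 : S) (1 : ℝ)‖) ∧
      -- lower bound off `A`
      (∀ i, i ∉ A →
        (1 - (d : ℝ) / ((d : ℝ) - 1) * ((d : ℝ) ^ ((d : ℝ) / ((d : ℝ) - 1)) - d)
            * (1 + (n : ℝ)) ^ ((d : ℝ) / ((d : ℝ) + 1))
            * ‖Q - lp.single (((d : ℝ≥0∞) + 1) / 2) (0 : S) (1 : ℝ)‖)
          * ∑ j ∈ A, Q (i - j) ≤ x i) := by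
  have hd' : (2 : ℝ) ≤ d := by exact_mod_cast hd
  have hd1 : 1 ≤ d := by omega
  set qq := Q - lp.single (((d : ℝ≥0∞) + 1) / 2) (0 : S) (1 : ℝ) with hqq
  set K := ‖qq‖ with hKdef
  have hK0 : 0 ≤ K := lp.norm_nonneg' _
  let q : S → ℝ := fun i => qq i
  have hqeq : ∀ i, Q i = q i + if i = 0 then 1 else 0 := by
    intro i
    have h : q i = Q i - (Pi.single (0 : S) (1 : ℝ) : S → ℝ) i := by
      simp only [q, hqq, lp.coeFn_sub, Pi.sub_apply, lp.coeFn_single]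
    rw [h, Pi.single_apply]
    ring
  have hq0 : q 0 = 0 := by have := hqeq 0; rw [hQ0] at this; simpa using this
  have hqpos : ∀ i, i ≠ 0 → 0 < q i := fun i hi => by
    have := hqeq i
    rw [if_neg hi, add_zero] at this
    rw [← this]
    exact hQpos i
  have hq : ∀ i, 0 ≤ q i := fun i => by
    rcases eq_or_ne i 0 with rfl | hi
    · exact hq0.ge
    · exact (hqpos i hi).le
  have hp : 0 < (((d : ℝ≥0∞) + 1) / 2).toReal := by
    rw [toReal_natCast_add_one_div_two]; positivity
  have hqabs : ∀ i, ‖qq i‖ = q i := fun i => Real.norm_of_nonneg (hq i)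
  have hqs : Summable fun i => q i ^ (((d : ℝ) + 1) / 2) := by
    have := (lp.memℓp qq).summable hp
    simpa only [hqabs, toReal_natCast_add_one_div_two] using this
  -- `K ^ ((d+1)/2)` is the sum itself, so its square is `K ^ (d+1)`.
  have hPK : (∑' i, q i ^ (((d : ℝ) + 1) / 2)) ^ 2 = K ^ (d + 1) := by
    have := lp.norm_rpow_eq_tsum hp qq
    simp only [hqabs, toReal_natCast_add_one_div_two] at this
    rw [← this, ← Real.rpow_natCast, ← Real.rpow_mul hK0, ← Real.rpow_natCast]
    congr 1
    push_cast
    ring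
  set ρ := rho d n with hρ
  set δ : ℝ := (d : ℝ) / ((d : ℝ) + 1) with hδ
  have hδ0 : 0 < δ := by positivity
  have hρ0 : 0 < ρ := rho_pos hd hn
  have hρl : ρ < lam d := rho_lt_lam hd hn
  have hl1 : lam d < 1 := lam_lt_one hd
  have hρ1 : ρ < 1 := hρl.trans hl1
  set c := ρ ^ (d + 1) + n with hc
  have hc0 : 0 < c := rho_pow_add_pos hd hn
  have hηc : eta d n * c ^ δ = ρ - ρ ^ d := eta_mul hd hn
  have hKc : K * c ^ δ ≤ ρ - ρ ^ d := by
    rw [← hηc]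
    exact mul_le_mul_of_nonneg_right hQ (Real.rpow_nonneg hc0.le _)
  obtain ⟨x, hx01, hxA, hxF, hxeq⟩ := exists_boundaryLaw hd hq hqs hρ0 hρl hl1
    (sub_pow_lt_lam hd hρ0.le hρl) (n := n) (by
      rw [hPK, ← mul_rpow_pow_succ hc0.le]
      exact pow_le_pow_left₀ (mul_nonneg hK0 (Real.rpow_nonneg hc0.le _)) hKc _) A hA
  have hx0 := fun i => (hx01 i).1
  have hx1 := fun i => (hx01 i).2
  set y : S → ℝ := fun i => ∑' j, q (i - j) * x j ^ d with hy
  -- summability of `x ^ (d + 1)`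
  have hxsplit : ∀ F : Finset S,
      ∑ i ∈ F, x i ^ (d + 1) ≤ ρ ^ (d + 1) + ∑ i ∈ A, x i ^ (d + 1) := by
    intro F
    rw [← Finset.sum_sdiff (Finset.inter_subset_left : F ∩ A ⊆ F)]
    refine add_le_add (hxF _ ?_) (Finset.sum_le_sum_of_subset_of_nonneg
      Finset.inter_subset_right fun i _ _ => pow_nonneg (hx0 i) _)
    rw [Finset.sdiff_inter_self_left]
    exact Finset.sdiff_disjoint
  have hxs : Summable fun i => x i ^ (d + 1) :=
    summable_of_sum_le (fun i => pow_nonneg (hx0 i) _) hxsplit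
  set X := ∑' i, x i ^ (d + 1) with hX
  have hX0 : 0 ≤ X := tsum_nonneg fun i => pow_nonneg (hx0 i) _
  have hXle : X ≤ ρ ^ (d + 1) + ∑ i ∈ A, x i ^ (d + 1) := hxs.tsum_le_of_sum_le hxsplit
  -- positivity
  have hysum : ∀ i, Summable fun j => q (i - j) * x j ^ d := fun i =>
    (summable_mul_pow_and_tsum_pow_le hd1 (fun j => hq (i - j)) hx0 hx1
      ((Equiv.subLeft i).summable_iff.2 hqs) hxs).1
  have hterm : ∀ i j, 0 ≤ q (i - j) * x j ^ d := fun i j =>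
    mul_nonneg (hq _) (pow_nonneg (hx0 j) d)
  have hQterm : ∀ i j, 0 ≤ Q (i - j) * x j ^ d := fun i j =>
    mul_nonneg (hQpos _).le (pow_nonneg (hx0 j) d)
  have hconv : ∀ i, (Summable fun j => Q (i - j) * x j ^ d) ∧
      ∑' j, Q (i - j) * x j ^ d = x i := by
    intro i
    have h := tsum_conv_eq i (hysum i)
    simp only [← hqeq] at h
    exact ⟨h.1, h.2.trans (hxeq i).symm⟩
  have hxpos : ∀ i, 0 < x i := by
    intro i
    obtain ⟨a, ha⟩ : A.Nonempty := Finset.card_pos.1 (by omega)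
    rw [← (hconv i).2]
    exact (hconv i).1.tsum_pos (hQterm i) a
      (mul_pos (hQpos _) (pow_pos ((lam_pos hd).trans_le (hxA a ha)) d))
  -- Since `q 0 = 0`, positivity needs a second point of `S`.
  have hypos : ∀ i, 0 < y i := by
    intro i
    obtain ⟨j, hj⟩ := exists_ne i
    exact (hysum i).tsum_pos (hterm i) j
      (mul_pos (hqpos _ (sub_ne_zero.2 hj.symm)) (pow_pos (hxpos j) d))
  have hxlt1 : ∀ i, x i < 1 := by
    intro i
    refine lt_of_le_of_ne (hx1 i) fun h => ?_
    have h1 : x i = x i ^ d + y i := hxeq i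
    have h2 := hypos i
    rw [h, one_pow] at h1
    linarith
  -- The source of the strict inequalities: `x < 1` on the nonempty set `A` makes the norm bound
  -- strict even when `K = η`.
  have hXc : X < c := by
    refine hXle.trans_lt ?_
    rw [hc, add_lt_add_iff_left, ← hA]
    have : ∑ i ∈ A, x i ^ (d + 1) < ∑ i ∈ A, 1 :=
      Finset.sum_lt_sum_of_nonempty (Finset.card_pos.1 (by omega)) fun i _ =>
        pow_lt_one₀ (hx0 i) (hxlt1 i) (Nat.succ_ne_zero d)
    simpa using this
  -- Young's inequality
  have hXδ : 0 ≤ X ^ δ := Real.rpow_nonneg hX0 _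
  have hYF : ∀ F : Finset S, ∑ i ∈ F, y i ^ (d + 1) ≤ (K * X ^ δ) ^ (d + 1) := by
    intro F
    obtain ⟨h1, h2⟩ := summable_conv_pow_and_tsum_le hd1 hq hx0 hx1 hqs hxs
    rw [hPK] at h2
    rw [mul_rpow_pow_succ hX0]
    exact (h1.sum_le_tsum F fun i _ => pow_nonneg (hypos i).le _).trans h2
  have hyle : ∀ i, y i ≤ K * X ^ δ := fun i =>
    le_of_pow_le_pow_left₀ (Nat.succ_ne_zero d) (mul_nonneg hK0 hXδ) (by simpa using hYF {i})
  have hXcδ : X ^ δ < c ^ δ := Real.rpow_lt_rpow hX0 hXc hδ0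
  have hylt : ∀ i, y i < ρ - ρ ^ d := by
    intro i
    rw [← hηc]
    exact (hyle i).trans_lt ((mul_le_mul_of_nonneg_right hQ hXδ).trans_lt
      (mul_lt_mul_of_pos_left hXcδ (eta_pos hd hn)))
  -- the norm off `A`
  have hxr : ∀ i ∉ A, x i ≤ ρ := fun i hi =>
    le_of_pow_le_pow_left₀ (Nat.succ_ne_zero d) hρ0.le
      (by simpa using hxF {i} (by simpa using hi))
  have hb : 0 < 1 - ρ ^ (d - 1) := one_sub_rho_pow_pos hd hn
  -- Off `A`, `x ≤ ρ` gives `y = x - x ^ d ≥ (1 - ρ ^ (d-1)) x`, which turns the bound on `y` into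
  -- one on `x`.
  have hxy : ∀ i ∉ A, x i ≤ (1 - ρ ^ (d - 1))⁻¹ * y i := by
    intro i hi
    rw [← div_eq_inv_mul, le_div_iff₀ hb]
    have h1 : x i = x i ^ d + y i := hxeq i
    have h2 : x i ^ d = x i ^ (d - 1) * x i := by rw [← pow_succ, Nat.sub_add_cancel hd1]
    have h3 := mul_le_mul_of_nonneg_right (pow_le_pow_left₀ (hx0 i) (hxr i hi) (d - 1)) (hx0 i)
    linarith
  have hmem : Memℓp (fun i : S => x i) ((d : ℝ≥0∞) + 1) := by
    refine memℓp_gen ?_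
    refine hxs.congr fun i => ?_
    rw [toReal_natCast_add_one, Real.norm_of_nonneg (hx0 i), ← Real.rpow_natCast]
    push_cast
    rfl
  let x' : lp (fun _ : S => ℝ) ((d : ℝ≥0∞) + 1) := ⟨fun i => x i, hmem⟩
  have hx' : ∀ i, x' i = x i := fun i => rfl
  have hnorm : ‖lpRestrict ((A : Set S)ᶜ) (le_refl ((d : ℝ≥0∞) + 1)) x'‖
      ≤ (1 - ρ ^ (d - 1))⁻¹ * (K * X ^ δ) := by
    refine norm_lpRestrict_compl_le A x'
      (mul_nonneg (inv_nonneg.2 hb.le) (mul_nonneg hK0 hXδ)) fun F hF => ?_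
    calc ∑ i ∈ F, |x' i| ^ (d + 1) ≤ ∑ i ∈ F, ((1 - ρ ^ (d - 1))⁻¹ * y i) ^ (d + 1) := by
          refine Finset.sum_le_sum fun i hi => ?_
          rw [hx', abs_of_nonneg (hx0 i)]
          exact pow_le_pow_left₀ (hx0 i) (hxy i (Finset.disjoint_left.1 hF hi)) _
      _ = (1 - ρ ^ (d - 1))⁻¹ ^ (d + 1) * ∑ i ∈ F, y i ^ (d + 1) := by
          simp only [mul_pow, ← Finset.mul_sum]
      _ ≤ (1 - ρ ^ (d - 1))⁻¹ ^ (d + 1) * (K * X ^ δ) ^ (d + 1) :=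
          mul_le_mul_of_nonneg_left (hYF F) (pow_nonneg (inv_nonneg.2 hb.le) _)
      _ = _ := (mul_pow _ _ _).symm
  have hfac : ρ - ρ ^ d = (1 - ρ ^ (d - 1)) * ρ := rho_sub_pow hd
  -- closeness to `1` on `A`
  set C := ((d : ℝ) ^ ((d : ℝ) / ((d : ℝ) - 1)) - d) / ((d : ℝ) - 1) with hC
  have hgap : 0 < lam d - lam d ^ d :=
    (rho_sub_pow_pos hd hn).trans (sub_pow_lt_lam hd hρ0.le hρl)
  have hCgap : C * (lam d - lam d ^ d) = 1 - lam d := const_mul_lam_sub_pow hd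
  have hC0 : 0 < C := by
    by_contra! h
    nlinarith
  have hXn : K * X ^ δ ≤ (1 + (n : ℝ)) ^ δ * K := by
    rw [mul_comm]
    refine mul_le_mul_of_nonneg_right (Real.rpow_le_rpow hX0 ?_ hδ0.le) hK0
    have : ρ ^ (d + 1) ≤ 1 := pow_le_one₀ hρ0.le hρ1.le
    linarith
  have hclose : ∀ i ∈ A, 1 - x i ≤ C * (1 + (n : ℝ)) ^ δ * K := by
    intro i hi
    -- On `[λ_d, 1]` the concave function `t - t ^ d` lies above its chord, so `1 - x ≤ C (x - x ^
    -- d) = C y`.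
    have h1 := one_sub_mul_sub_pow_le (d := d) (lam_pos hd).le hl1 (hxA i hi) (hx1 i)
    have h2 : x i - x i ^ d = y i := by
      have : x i = x i ^ d + y i := hxeq i
      linarith
    rw [h2, ← hCgap, mul_right_comm] at h1
    have h3 := le_of_mul_le_mul_right h1 hgap
    rw [mul_assoc]
    exact h3.trans (mul_le_mul_of_nonneg_left ((hyle i).trans hXn) hC0.le)
  refine ⟨x', hxpos, fun i => (hconv i).1, fun i => (hconv i).2.symm,
    norm_lpRestrict_top_le _ x', ?_, hρl, ?_, ?_, ?_, ?_⟩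
  · refine hnorm.trans_lt ?_
    rw [inv_mul_lt_iff₀ hb, ← hfac, ← hηc]
    exact (mul_le_mul_of_nonneg_right hQ hXδ).trans_lt
      (mul_lt_mul_of_pos_left hXcδ (eta_pos hd hn))
  · refine fun i hi => ⟨lt_of_le_of_ne (hxA i hi) fun h => ?_, hxlt1 i⟩
    have h1 : x i = x i ^ d + y i := hxeq i
    have h2 := hylt i
    -- Equality `x i = λ_d` would give `y i = λ_d - λ_d ^ d > ρ - ρ ^ d`.
    have h3 := sub_pow_lt_lam hd hρ0.le hρl
    rw [h, hx'] at h3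
    linarith
  · refine hnorm.trans ?_
    have h1 : ρ / eta d n = (1 - ρ ^ (d - 1))⁻¹ * c ^ δ := by
      rw [div_eq_iff (eta_pos hd hn).ne', mul_assoc, mul_comm (c ^ δ), hηc, hfac,
        inv_mul_cancel_left₀ hb.ne']
    rw [h1, mul_assoc, mul_comm (c ^ δ)]
    exact mul_le_mul_of_nonneg_left (mul_le_mul_of_nonneg_left hXcδ.le hK0)
      (inv_nonneg.2 hb.le)
  · exact fun i hi => ⟨sub_pos.2 (hxlt1 i), hclose i hi⟩
  · intro i _
    rw [hx', ← (hconv i).2]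
    -- Only the terms with `j ∈ A` are kept; Bernoulli's inequality `x j ^ d ≥ 1 - d (1 - x j)` and
    -- closeness to `1` on `A` bound them below.
    refine le_trans ?_ ((hconv i).1.sum_le_tsum A fun j _ => hQterm i j)
    rw [Finset.mul_sum]
    refine Finset.sum_le_sum fun j hj => ?_
    rw [mul_comm]
    refine mul_le_mul_of_nonneg_left ?_ (hQpos _).le
    have h1 := one_add_mul_le_pow (show (-2 : ℝ) ≤ x j - 1 by linarith [hx0 j]) d
    rw [add_sub_cancel] at h1
    have h2 := mul_le_mul_of_nonneg_left (hclose j hj) (by positivity : (0 : ℝ) ≤ d)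
    have h3 : (d : ℝ) / ((d : ℝ) - 1) * ((d : ℝ) ^ ((d : ℝ) / ((d : ℝ) - 1)) - d)
        * (1 + (n : ℝ)) ^ δ * K = d * (C * (1 + (n : ℝ)) ^ δ * K) := by
      rw [hC]; ring
    rw [h3]
    linarith
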